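/- Fix the following notation. For routing vectors $r_1,\dots,r_m\in\mathbb{R}^d$ and $S\subseteq[m]=\{1,\dots,m\}$ with $|S|=k$, let $$U_S=\{x\in\mathbb{R}^d : \langle x,r_i\rangle>\langle x,r_j\rangle \text{ for all } i\in S,\ j\in[m]\setminus S\}.$$ An $(m,k,w,d)$-MoE model with activation function $\sigma:\mathbb{R}\to\mathbb{R}$ is given by routing vectors $r_1,\dots,r_m\in\mathbb{R}^d$ and matrices $A_1,\dots,A_m,B_1,\dots,B_m\in\mathbb{R}^{d\times w}$; it computes the function $f:\mathbb{R}^d\to\mathbb{R}^d$ with $$f(x)=\sum_{j\in S}A_j\,\sigma(B_j^{\top}x)\quad\text{if } x\in U_S,\ |S|=k,$$ where $\sigma$ is applied elementwise, and $f(x)=0$ if $x$ lies in none of the (pairwise disjoint) sets $U_S$ with $|S|=k$. **Theorem 1 (Benefits of granularity; constant activation).** There are universal constants $C,c>0$ such that the following holds for the constant activation function $\sigma\equiv 1$. Let $m,k,w,d,m',k'$ be nonnegative integers with $k\ge 1$ and $w\ge 1$, and let $\mu$ be a rotationally invariant probability measure on $\mathbb{R}^d$ other than the point mass at $0$. Suppose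 that $d\ge Ck(\log m)^2$, that $m\ge 2k$, and that $$\binom{m'}{k'}<c\binom{m}{k}^{0.99}.$$ Then there is an $(m,k,w,d)$-MoE model $f$, with pairwise distinct routing vectors, such that for every $w'\ge 0$ and every $(m',k',w',d)$-MoE model $f'$, $$\mathbb{E}_{x\sim\mu}\|f(x)-f'(x)\|^2>c\,\mathbb{E}_{x\sim\mu}\|f(x)\|^2.$$ -/

import Mathlib

open MeasureTheory

noncomputable section

/-- Parameters of an `(m, k, w, d)`-MoE model: `m` routing vectors in `ℝ^d` and `m` experts
of width `w` given by matrices `A j, B j ∈ ℝ^{d × w}`. The number `k` of active experts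
enters in `MoE.eval`. -/
structure MoE (m k w d : ℕ) where
  routing : Fin m → EuclideanSpace ℝ (Fin d)
  A : Fin m → Matrix (Fin d) (Fin w) ℝ
  B : Fin m → Matrix (Fin d) (Fin w) ℝ

namespace MoE

variable {m k w d : ℕ}

/-- The routing region `U_S`: the inputs whose inner product with every routing vector
indexed by `S` is strictly larger than with every routing vector not indexed by `S`. -/
def region (f : MoE m k w d) (S : Finset (Fin m)) : Set (EuclideanSpace ℝ (Fin d)) :=
  {x | ∀ i ∈ S, ∀ j ∉ S, inner ℝ x (f.routing j) < inner ℝ x (f.routing i)}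

/-- The output `A_j σ(B_jᵀ x)` of the `j`-th expert, with `σ` applied elementwise. -/
def expert (f : MoE m k w d) (σ : ℝ → ℝ) (j : Fin m) (x : EuclideanSpace ℝ (Fin d)) :
    EuclideanSpace ℝ (Fin d) :=
  WithLp.toLp 2 ((f.A j).mulVec (fun l => σ ((f.B j).transpose.mulVec x.ofLp l)))

open scoped Classical in
/-- The function computed by the model: `∑ j ∈ S, A_j σ(B_jᵀ x)` if `x ∈ U_S` for a
`k`-element set `S` (there is at most one, see `eval_of_mem`), and `0` at the inputs that lie
in no region (see `eval_of_notMem`). -/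
def eval (f : MoE m k w d) (σ : ℝ → ℝ) (x : EuclideanSpace ℝ (Fin d)) :
    EuclideanSpace ℝ (Fin d) :=
  ∑ S ∈ (Finset.univ : Finset (Fin m)).powersetCard k,
    if x ∈ f.region S then ∑ j ∈ S, f.expert σ j x else 0

theorem region_unique (f : MoE m k w d) {S T : Finset (Fin m)} (h : S.card = T.card)
    {x : EuclideanSpace ℝ (Fin d)} (hS : x ∈ f.region S) (hT : x ∈ f.region T) : S = T := by
  by_contra hne
  have h1 : ¬ S ⊆ T := fun hs => hne (Finset.eq_of_subset_of_card_le hs h.ge)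
  have h2 : ¬ T ⊆ S := fun hs => hne (Finset.eq_of_subset_of_card_le hs h.le).symm
  obtain ⟨i, hiS, hiT⟩ := Finset.not_subset.mp h1
  obtain ⟨j, hjT, hjS⟩ := Finset.not_subset.mp h2
  exact lt_asymm (hS i hiS j hjS) (hT j hjT i hiT)

theorem eval_of_mem (f : MoE m k w d) (σ : ℝ → ℝ) {S : Finset (Fin m)} (hS : S.card = k)
    {x : EuclideanSpace ℝ (Fin d)} (hx : x ∈ f.region S) :
    f.eval σ x = ∑ j ∈ S, f.expert σ j x := by
  classical
  unfold eval
  rw [Finset.sum_eq_single S]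
  · simp [hx]
  · intro T hT hne
    rw [if_neg]
    intro hxT
    exact hne (f.region_unique ((Finset.mem_powersetCard.mp hT).2.trans hS.symm) hxT hx)
  · intro h
    exact absurd (Finset.mem_powersetCard.mpr ⟨Finset.subset_univ S, hS⟩) h

theorem eval_of_notMem (f : MoE m k w d) (σ : ℝ → ℝ) {x : EuclideanSpace ℝ (Fin d)}
    (hx : ∀ S : Finset (Fin m), S.card = k → x ∉ f.region S) : f.eval σ x = 0 := by
  unfold eval
  exact Finset.sum_eq_zero fun S hS => if_neg (hx S (Finset.mem_powersetCard.mp hS).2)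

end MoE

/-- A measure on `ℝ^d` is rotationally invariant if every orthogonal transformation
preserves it. -/
def RotationallyInvariant {d : ℕ} (μ : Measure (EuclideanSpace ℝ (Fin d))) : Prop :=
  ∀ R : EuclideanSpace ℝ (Fin d) ≃ₗᵢ[ℝ] EuclideanSpace ℝ (Fin d), μ.map R = μ

/-- The constant activation function. -/
def constActivation : ℝ → ℝ := fun _ => 1

end

/-! With constant activation a model is a step function. Write N and N' for the binomial
coefficients of (m, k) and (m', k'). Whatever its width, a competitor takes at most N' + 1 values,
so the theorem is a quantization bound: f must be a source that few codewords cannot describe.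

Two properties make f such a source. The first concerns routing
(`RotationallyInvariant.exists_routing`): two independent inputs select sets S, T with |S \ T| ≤
k/10000 with probability at most N^(-0.99). The second concerns values (`exists_signVectors`): if
the experts output random sign vectors, the mean square of f is at most 2kd, while sums over sets
that are not close differ by order kd in squared norm. The union bound over N² pairs is affordable
because d is large compared with k log m. In `quantization_lower_bound`, a small error would put
more than half of the mass near codewords. By Cauchy–Schwarz, two independent inputs would then
often lie near the same codeword, which forces their sets to be close; this needs about N^0.99
codewords.

For the routing, if m ≤ d, orthonormal vectors make all k-sets equally likely, and only N^0.01 sets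
are close to a given one. If m > d, the lower bound on d makes m/k enormous, and Gaussian routing
vectors work on average. Selected scores typically exceed t‖x‖ with t² about 2 log(m/k). For nearly
orthogonal inputs, one expert is that high for both with probability about (k/m)², so a near-common
selection costs about (k/m)^(2k) against about (m/k)^k choices of experts. Inputs with large
positive correlation are rare by concentration on the sphere. An atom of μ at 0 is removed by
conditioning. -/

/-! ### Random sign vectors: moments, small balls, separation -/

/-- The sign attached to a bit. -/
def bitSign (b : Bool) : ℝ := if b then 1 else -1

theorem bitSign_sq (b : Bool) : bitSign b ^ 2 = 1 := by cases b <;> simp [bitSign]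

/-- A sum over bit vectors of a function of a signed sum splits off the first coordinate. -/
theorem sum_bits_succ {n : ℕ} (a : Fin (n + 1) → ℝ) (F : ℝ → ℝ) :
    ∑ e : Fin (n + 1) → Bool, F (∑ j, a j * bitSign (e j)) =
      ∑ e : Fin n → Bool, (F (∑ j, a j.succ * bitSign (e j) + a 0) +
        F (∑ j, a j.succ * bitSign (e j) - a 0)) := by
  rw [← (Fin.consEquiv fun _ : Fin (n + 1) => Bool).sum_comp, Fintype.sum_prod_type,
    Fintype.sum_bool, ← Finset.sum_add_distrib]
  refine Finset.sum_congr rfl fun e _ => ?_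
  simp only [Fin.consEquiv_apply, Fin.sum_univ_succ, Fin.cons_zero, Fin.cons_succ, bitSign]
  congr 2 <;> simp <;> ring

theorem sum_bits_sq {n : ℕ} (a : Fin n → ℝ) :
    ∑ e : Fin n → Bool, (∑ j, a j * bitSign (e j)) ^ 2 = 2 ^ n * ∑ j, a j ^ 2 := by
  induction n with
  | zero => simp
  | succ n ih =>
    rw [sum_bits_succ a (fun z => z ^ 2)]
    have h : ∀ z : ℝ, (z + a 0) ^ 2 + (z - a 0) ^ 2 = 2 * z ^ 2 + 2 * a 0 ^ 2 := fun z => by ring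
    simp only [h, Finset.sum_add_distrib, ← Finset.mul_sum, ih, Fin.sum_univ_succ]
    simp
    ring

/-- Khintchine's inequality for fourth moments: odd terms cancel when one sign is flipped, and the
induction closes with the Gaussian constant 3. -/
theorem sum_bits_pow_four_le {n : ℕ} (a : Fin n → ℝ) :
    ∑ e : Fin n → Bool, (∑ j, a j * bitSign (e j)) ^ 4 ≤ 2 ^ n * (3 * (∑ j, a j ^ 2) ^ 2) := by
  induction n with
  | zero => simp
  | succ n ih =>
    rw [sum_bits_succ a (fun z => z ^ 4)]
    have h : ∀ z : ℝ, (z + a 0) ^ 4 + (z - a 0) ^ 4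
        = 2 * z ^ 4 + 12 * a 0 ^ 2 * z ^ 2 + 2 * a 0 ^ 4 := fun z => by ring
    simp only [h, Finset.sum_add_distrib, ← Finset.mul_sum, sum_bits_sq, Fin.sum_univ_succ]
    have := ih (fun j => a j.succ)
    simp only [Finset.sum_const, Finset.card_univ, Fintype.card_fun, Fintype.card_bool,
      Fintype.card_fin, nsmul_eq_mul, Nat.cast_pow, Nat.cast_ofNat]
    have h4 : (0 : ℝ) ≤ 2 ^ n * a 0 ^ 4 := by positivity
    rw [pow_succ (2 : ℝ) n]
    nlinarith

/-- Averaging exp(-u) ≤ 1 - u + u²/2 at u = Z²/(3s), with the second and fourth moments of Z, gives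
1 - 1/3 + 1/6 = 5/6. -/
theorem sum_bits_exp_neg_sq_le {n : ℕ} (a : Fin n → ℝ) (ha : 0 < ∑ j, a j ^ 2) :
    ∑ e : Fin n → Bool, Real.exp (-(∑ j, a j * bitSign (e j)) ^ 2 / (3 * ∑ j, a j ^ 2)) ≤
      2 ^ n * (5 / 6) := by
  set s := ∑ j, a j ^ 2 with hs
  have hexp : ∀ u : ℝ, 0 ≤ u → Real.exp (-u) ≤ 1 - u + u ^ 2 / 2 := by
    intro u hu
    have h1 := Real.quadratic_le_exp_of_nonneg hu
    rw [Real.exp_neg, inv_le_iff_one_le_mul₀ (Real.exp_pos u)]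
    have h0 : 0 ≤ 1 - u + u ^ 2 / 2 := by nlinarith [sq_nonneg (u - 1)]
    calc (1 : ℝ) ≤ (1 - u + u ^ 2 / 2) * (1 + u + u ^ 2 / 2) := by nlinarith [sq_nonneg (u ^ 2)]
      _ ≤ _ := mul_le_mul_of_nonneg_left h1 h0
  calc _ ≤ ∑ e : Fin n → Bool, (1 - (∑ j, a j * bitSign (e j)) ^ 2 * (1 / (3 * s))
        + (∑ j, a j * bitSign (e j)) ^ 4 * (1 / (18 * s ^ 2))) := by
        refine Finset.sum_le_sum fun e _ => ?_
        have := hexp ((∑ j, a j * bitSign (e j)) ^ 2 / (3 * s)) (by positivity)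
        rw [neg_div]
        refine this.trans (le_of_eq ?_)
        field_simp
        ring
    _ ≤ 2 ^ n - 2 ^ n * s * (1 / (3 * s)) + 2 ^ n * (3 * s ^ 2) * (1 / (18 * s ^ 2)) := by
        rw [Finset.sum_add_distrib, Finset.sum_sub_distrib, ← Finset.sum_mul, ← Finset.sum_mul,
          sum_bits_sq]
        simp only [Finset.sum_const, Finset.card_univ, Fintype.card_fun, Fintype.card_bool,
          Fintype.card_fin, nsmul_eq_mul, Nat.cast_pow, Nat.cast_ofNat, mul_one]
        have := sum_bits_pow_four_le a
        have h2 : (0 : ℝ) ≤ 1 / (18 * s ^ 2) := by positivity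
        have := mul_le_mul_of_nonneg_right this h2
        linarith
    _ = _ := by field_simp; ring

/-- Small ball estimate: few sign matrices send `a` to a vector much shorter than expected. -/
theorem card_signMatrix_small_le {n d : ℕ} (a : Fin n → ℝ) (ha : 0 < ∑ j, a j ^ 2) :
    ((Finset.univ.filter fun e : Fin d → Fin n → Bool =>
      ∑ l, (∑ j, a j * bitSign (e l j)) ^ 2 < 3 / 10 * (∑ j, a j ^ 2) * d).card : ℝ) ≤
      2 ^ (n * d) * (93 / 100 : ℝ) ^ d := by
  set s := ∑ j, a j ^ 2 with hs
  have hexp : Real.exp (1 / 10) * (5 / 6) ≤ 93 / 100 := by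
    have := Real.exp_bound_div_one_sub_of_interval (x := 1 / 10) (by norm_num) (by norm_num)
    norm_num at this ⊢
    linarith
  -- Exponential Markov: the threshold 3sd/10 divided by 3s is d/10, so each row contributes a
  -- factor exp(1/10) · 5/6 < 93/100.
  have key : ∀ e : Fin d → Fin n → Bool,
      (if ∑ l, (∑ j, a j * bitSign (e l j)) ^ 2 < 3 / 10 * s * d then (1 : ℝ) else 0) ≤
      Real.exp (1 / 10) ^ d *
        ∏ l, Real.exp (-(∑ j, a j * bitSign (e l j)) ^ 2 / (3 * s)) := by
    intro e
    split_ifs with h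
    · rw [← Real.exp_nat_mul, ← Real.exp_sum, ← Real.exp_add, Real.one_le_exp_iff]
      simp only [neg_div, Finset.sum_neg_distrib, ← Finset.sum_div]
      rw [← sub_eq_add_neg, sub_nonneg, div_le_iff₀ (by positivity)]
      nlinarith
    · positivity
  rw [Finset.card_filter]
  push_cast
  calc _ ≤ ∑ e : Fin d → Fin n → Bool, Real.exp (1 / 10) ^ d *
        ∏ l, Real.exp (-(∑ j, a j * bitSign (e l j)) ^ 2 / (3 * s)) :=
        Finset.sum_le_sum fun e _ => key e
    _ = Real.exp (1 / 10) ^ d *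
        (∑ e : Fin n → Bool, Real.exp (-(∑ j, a j * bitSign (e j)) ^ 2 / (3 * s))) ^ d := by
        rw [← Finset.mul_sum, Fintype.sum_pow]
    _ ≤ Real.exp (1 / 10) ^ d * (2 ^ n * (5 / 6)) ^ d := by
        have := sum_bits_exp_neg_sq_le a ha
        gcongr
    _ = 2 ^ (n * d) * (Real.exp (1 / 10) * (5 / 6)) ^ d := by
        rw [mul_pow, mul_pow, pow_mul]; ring
    _ ≤ _ := by
        gcongr

/-- Random sign vectors: for given weights on the `k`-sets there are sign vectors whose sums over
`k`-sets have the expected mean square norm, and which separate sufficiently different `k`-sets. -/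
theorem exists_signVectors {m k d : ℕ} (hd : 0 < d) (hk : 0 < k) (ε : ℝ) (hε : 0 ≤ ε)
    (a : Finset (Fin m) → ℝ) (ha : ∀ S, 0 ≤ a S)
    (ha1 : ∑ S ∈ Finset.univ.powersetCard k, a S = 1)
    (hN : (m.choose k : ℝ) ^ 2 * (93 / 100 : ℝ) ^ d ≤ 1 / 4) :
    ∃ v : Fin m → EuclideanSpace ℝ (Fin d),
      (∑ S ∈ Finset.univ.powersetCard k, a S * ‖∑ j ∈ S, v j‖ ^ 2 ≤ 2 * k * d) ∧
      ∀ S ∈ Finset.univ.powersetCard k, ∀ T ∈ Finset.univ.powersetCard k,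
        ε * k < (S \ T).card →
        3 / 5 * ε * k * d ≤ ‖∑ j ∈ S, v j - ∑ j ∈ T, v j‖ ^ 2 := by
  classical
  set P := (Finset.univ : Finset (Fin m)).powersetCard k with hP
  let ind : Finset (Fin m) → Fin m → ℝ := fun S j => if j ∈ S then 1 else 0
  let V : (Fin d → Fin m → Bool) → Fin m → EuclideanSpace ℝ (Fin d) :=
    fun e j => WithLp.toLp 2 fun l => bitSign (e l j)
  have hVS : ∀ e S, ‖∑ j ∈ S, V e j‖ ^ 2 = ∑ l, (∑ j, ind S j * bitSign (e l j)) ^ 2 := by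
    intro e S
    rw [EuclideanSpace.real_norm_sq_eq]
    refine Finset.sum_congr rfl fun l _ => ?_
    simp [V, ind]
  have hVST : ∀ e S T, ‖∑ j ∈ S, V e j - ∑ j ∈ T, V e j‖ ^ 2 =
      ∑ l, (∑ j, (ind S j - ind T j) * bitSign (e l j)) ^ 2 := by
    intro e S T
    rw [EuclideanSpace.real_norm_sq_eq]
    refine Finset.sum_congr rfl fun l _ => ?_
    simp [V, ind, sub_mul, Finset.sum_sub_distrib]
  have hind : ∀ S ∈ P, ∑ j, ind S j ^ 2 = k := by
    intro S hS
    simp [ind, (Finset.mem_powersetCard.mp hS).2]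
  -- The small ball threshold for S, T is thus 3/10 · 2|S \ T| · d, which exceeds 3/5 · εkd for
  -- pairs that are not close.
  have hindd : ∀ S ∈ P, ∀ T ∈ P, ∑ j, (ind S j - ind T j) ^ 2 = 2 * (S \ T).card := by
    intro S hS T hT
    have h1 : (S \ T).card = (T \ S).card := Finset.card_sdiff_comm
      ((Finset.mem_powersetCard.mp hS).2.trans (Finset.mem_powersetCard.mp hT).2.symm)
    have h2 : ∀ j, (ind S j - ind T j) ^ 2 = (if j ∈ S \ T then 1 else 0) +
        (if j ∈ T \ S then 1 else 0) := by
      intro j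
      by_cases hj : j ∈ S <;> by_cases hj' : j ∈ T <;> simp [ind, hj, hj']
    rw [Finset.sum_congr rfl fun j _ => h2 j, Finset.sum_add_distrib]
    simp only [Finset.sum_ite_mem, Finset.univ_inter, Finset.sum_const, nsmul_eq_mul, mul_one, h1]
    ring
  have hk' : (0 : ℝ) < k := by exact_mod_cast hk
  have hd' : (0 : ℝ) < d := by exact_mod_cast hd
  let bad : Finset (Fin m) → Finset (Fin m) → (Fin d → Fin m → Bool) → ℝ := fun S T e =>
    if ε * k < (S \ T).card ∧ ‖∑ j ∈ S, V e j - ∑ j ∈ T, V e j‖ ^ 2 < 3 / 5 * ε * k * d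
      then 1 else 0
  have hbad0 : ∀ S T e, 0 ≤ bad S T e := fun S T e => by dsimp only [bad]; split_ifs <;> simp
  have hbad : ∀ S ∈ P, ∀ T ∈ P, ∑ e, bad S T e ≤ 2 ^ (m * d) * (93 / 100 : ℝ) ^ d := by
    intro S hS T hT
    by_cases hc : ε * k < (S \ T).card
    · have h0 : 0 < ∑ j, (ind S j - ind T j) ^ 2 := by
        rw [hindd S hS T hT]
        have : 0 ≤ ε * k := by positivity
        linarith
      refine le_trans ?_ (card_signMatrix_small_le (d := d) _ h0)
      rw [Finset.card_filter]
      push_cast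
      refine Finset.sum_le_sum fun e _ => ?_
      simp only [bad, hVST, hindd S hS T hT, hc, true_and]
      split_ifs with h1 h2
      · exact le_rfl
      · exfalso
        apply h2
        refine h1.trans_le ?_
        have := mul_le_mul_of_nonneg_right hc.le hd'.le
        nlinarith
      · norm_num
      · exact le_rfl
    · simp only [bad, hc, false_and, if_false, Finset.sum_const_zero]
      positivity
  have hmean : ∑ e : Fin d → Fin m → Bool, ∑ S ∈ P, a S * ‖∑ j ∈ S, V e j‖ ^ 2
      = 2 ^ (m * d) * (k * d) := by
    have hone : ∀ S ∈ P, ∑ e : Fin d → Fin m → Bool, ‖∑ j ∈ S, V e j‖ ^ 2 =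
        2 ^ (m * d) * (k * d) := by
      intro S hS
      simp only [hVS]
      rw [Finset.sum_comm]
      have : ∀ l : Fin d, ∑ e : Fin d → Fin m → Bool, (∑ j, ind S j * bitSign (e l j)) ^ 2
          = 2 ^ (m * d) * k := by
        intro l
        -- Row l is split off; the remaining rows only contribute a counting factor.
        obtain ⟨n, rfl⟩ : ∃ n, d = n + 1 := ⟨d - 1, by omega⟩
        rw [← (Fin.insertNthEquiv (fun _ : Fin (n + 1) => Fin m → Bool) l).sum_comp,
          Fintype.sum_prod_type]
        simp only [Fin.insertNthEquiv_apply, Fin.insertNth_apply_same, Finset.sum_const,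
          ← Finset.smul_sum, sum_bits_sq, hind S hS]
        simp [pow_mul, pow_succ]
        ring
      rw [Finset.sum_congr rfl fun l _ => this l]
      simp
      ring
    rw [Finset.sum_comm]
    simp only [← Finset.mul_sum]
    rw [Finset.sum_congr rfl fun S hS => by rw [hone S hS], ← Finset.sum_mul, ha1, one_mul]
  have hcardP : (P.card : ℝ) = m.choose k := by simp [hP]
  -- First moment method: the average is at most 1 + 2 · 1/4 < 2. A choice below 2 has mean square
  -- at most 2kd and fewer than one bad pair, hence none.
  have htot : ∑ e : Fin d → Fin m → Bool, ((∑ S ∈ P, a S * ‖∑ j ∈ S, V e j‖ ^ 2) / (k * d) +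
      2 * ∑ S ∈ P, ∑ T ∈ P, bad S T e) < ∑ e : Fin d → Fin m → Bool, (2 : ℝ) := by
    rw [Finset.sum_add_distrib, ← Finset.sum_div, hmean, ← Finset.mul_sum, Finset.sum_comm]
    have h1 : ∑ S ∈ P, ∑ e, ∑ T ∈ P, bad S T e ≤
        ∑ S ∈ P, ∑ T ∈ P, 2 ^ (m * d) * (93 / 100 : ℝ) ^ d := by
      refine Finset.sum_le_sum fun S hS => ?_
      rw [Finset.sum_comm]
      exact Finset.sum_le_sum fun T hT => hbad S hS T hT
    have h2 : ∑ S ∈ P, ∑ T ∈ P, 2 ^ (m * d) * (93 / 100 : ℝ) ^ d ≤ 2 ^ (m * d) * (1 / 4) := by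
      simp only [Finset.sum_const, nsmul_eq_mul, hcardP]
      calc _ = 2 ^ (m * d) * ((m.choose k : ℝ) ^ 2 * (93 / 100 : ℝ) ^ d) := by ring
        _ ≤ _ := by gcongr
    have h3 : (0 : ℝ) < 2 ^ (m * d) := by positivity
    rw [mul_div_assoc, div_self (by positivity)]
    simp only [Finset.sum_const, Finset.card_univ, Fintype.card_fun, Fintype.card_bool,
      Fintype.card_fin, nsmul_eq_mul, Nat.cast_pow, Nat.cast_ofNat, mul_one, ← pow_mul]
    linarith
  obtain ⟨e, -, he⟩ := Finset.exists_lt_of_sum_lt htot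
  have hb0 : 0 ≤ ∑ S ∈ P, ∑ T ∈ P, bad S T e :=
    Finset.sum_nonneg fun S _ => Finset.sum_nonneg fun T _ => hbad0 S T e
  have ha0 : 0 ≤ (∑ S ∈ P, a S * ‖∑ j ∈ S, V e j‖ ^ 2) / (k * d) :=
    div_nonneg (Finset.sum_nonneg fun S _ => mul_nonneg (ha S) (sq_nonneg _)) (by positivity)
  refine ⟨V e, ?_, ?_⟩
  · have : (∑ S ∈ P, a S * ‖∑ j ∈ S, V e j‖ ^ 2) / (k * d) ≤ 2 := by linarith
    rw [div_le_iff₀ (by positivity)] at this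
    linarith
  · intro S hS T hT hST
    by_contra hlt
    have h1 : bad S T e = 1 := if_pos ⟨hST, not_le.mp hlt⟩
    have h2 : bad S T e ≤ ∑ T ∈ P, bad S T e :=
      Finset.single_le_sum (f := fun T => bad S T e) (fun T _ => hbad0 S T e) hT
    have h3 : ∑ T ∈ P, bad S T e ≤ ∑ S ∈ P, ∑ T ∈ P, bad S T e :=
      Finset.single_le_sum (f := fun S => ∑ T ∈ P, bad S T e)
        (fun S _ => Finset.sum_nonneg fun T _ => hbad0 S T e) hS
    linarith

/-! ### Quantization by few values -/

/-- A second moment bound: if independent draws of `S` are close with small probability, then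
a function of `S` which separates far pairs is badly approximated by few values `y`. -/
theorem quantization_lower_bound {ι E : Type*} [NormedAddCommGroup E] (P : Finset ι)
    (Y : Finset E) (v : ι → E) (b : ι → E → ℝ) (hb : ∀ S y, 0 ≤ b S y)
    (hb1 : ∑ S ∈ P, ∑ y ∈ Y, b S y = 1) (close : ι → ι → Prop) [DecidableRel close]
    {D η : ℝ} (hfar : ∀ S ∈ P, ∀ T ∈ P, ¬ close S T → D ≤ ‖v S - v T‖ ^ 2)
    (hη : ∑ S ∈ P, ∑ T ∈ P, (if close S T then (∑ y ∈ Y, b S y) * ∑ y ∈ Y, b T y else 0) ≤ η)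
    (hY : 4 * Y.card * η < 1) :
    D / 8 ≤ ∑ S ∈ P, ∑ y ∈ Y, b S y * ‖v S - y‖ ^ 2 := by
  classical
  rcases le_or_gt D 0 with hD | hD
  · have : 0 ≤ ∑ S ∈ P, ∑ y ∈ Y, b S y * ‖v S - y‖ ^ 2 :=
      Finset.sum_nonneg fun S _ => Finset.sum_nonneg fun y _ => mul_nonneg (hb S y) (sq_nonneg _)
    linarith
  by_contra! hlt
  -- The mass within squared distance D/4 of its codeword. A total error below D/8 leaves more than
  -- half of the mass here, by Markov.
  let g : ι → E → ℝ := fun S y => if ‖v S - y‖ ^ 2 < D / 4 then b S y else 0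
  have hg0 : ∀ S y, 0 ≤ g S y := fun S y => by dsimp only [g]; split_ifs <;> simp [hb]
  have hgb : ∀ S y, g S y ≤ b S y := fun S y => by dsimp only [g]; split_ifs <;> simp [hb]
  have hhalf : 1 / 2 < ∑ S ∈ P, ∑ y ∈ Y, g S y := by
    have h1 : ∀ S y, D / 4 * (b S y - g S y) ≤ b S y * ‖v S - y‖ ^ 2 := by
      intro S y
      dsimp only [g]
      split_ifs with h
      · have := mul_nonneg (hb S y) (sq_nonneg ‖v S - y‖)
        simpa using this
      · have := mul_le_mul_of_nonneg_left (not_lt.mp h) (hb S y)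
        linarith
    have h2 : D / 4 * (1 - ∑ S ∈ P, ∑ y ∈ Y, g S y) ≤
        ∑ S ∈ P, ∑ y ∈ Y, b S y * ‖v S - y‖ ^ 2 := by
      rw [← hb1, ← Finset.sum_sub_distrib, Finset.mul_sum]
      refine Finset.sum_le_sum fun S _ => ?_
      rw [← Finset.sum_sub_distrib, Finset.mul_sum]
      exact Finset.sum_le_sum fun y _ => h1 S y
    by_contra! h3
    nlinarith
  -- Two points within √D/2 of one codeword are within √D of each other, so their indices are close.
  have hclose : ∀ S ∈ P, ∀ T ∈ P, ∀ y, g S y * g T y ≤ if close S T then b S y * b T y else 0 := by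
    intro S hS T hT y
    split_ifs with hc
    · exact mul_le_mul (hgb S y) (hgb T y) (hg0 T y) (hb S y)
    · by_cases h1 : ‖v S - y‖ ^ 2 < D / 4
      · by_cases h2 : ‖v T - y‖ ^ 2 < D / 4
        · exfalso
          have h3 := hfar S hS T hT hc
          have h4 : ‖v S - v T‖ ≤ ‖v S - y‖ + ‖v T - y‖ := by
            have := norm_sub_le (v S - y) (v T - y)
            simpa using this
          nlinarith [norm_nonneg (v S - v T), sq_nonneg (‖v S - y‖ - ‖v T - y‖)]
        · simp [g, h2]
      · simp [g, h1]
  -- Cauchy–Schwarz over the codewords turns mass near codewords into the probability that two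
  -- independent draws share one.
  have hsq : (∑ S ∈ P, ∑ y ∈ Y, g S y) ^ 2 ≤ Y.card * η := by
    rw [Finset.sum_comm]
    calc (∑ y ∈ Y, ∑ S ∈ P, g S y) ^ 2 ≤ Y.card * ∑ y ∈ Y, (∑ S ∈ P, g S y) ^ 2 :=
          sq_sum_le_card_mul_sum_sq
      _ ≤ Y.card * η := by
          gcongr
          refine le_trans ?_ hη
          simp only [sq, Finset.sum_mul_sum]
          rw [Finset.sum_comm]
          refine Finset.sum_le_sum fun S hS => ?_
          rw [Finset.sum_comm]
          refine Finset.sum_le_sum fun T hT => ?_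
          calc ∑ y ∈ Y, g S y * g T y ≤ ∑ y ∈ Y, if close S T then b S y * b T y else 0 :=
                Finset.sum_le_sum fun y _ => hclose S hS T hT y
            _ ≤ _ := by
                split_ifs with hc
                · exact Finset.sum_le_sum fun y hy => Finset.single_le_sum
                    (f := fun y' => b S y * b T y') (fun y' _ => mul_nonneg (hb S y) (hb T y')) hy
                · simp
  nlinarith

/-! ### Rotationally invariant measures and spherical caps -/

/-- The reflection in the hyperplane orthogonal to u - v exchanges vectors of equal norm. -/
theorem exists_linearIsometryEquiv_apply_eq {d : ℕ} {u v : EuclideanSpace ℝ (Fin d)}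
    (h : ‖u‖ = ‖v‖) :
    ∃ R : EuclideanSpace ℝ (Fin d) ≃ₗᵢ[ℝ] EuclideanSpace ℝ (Fin d), R u = v :=
  ⟨(ℝ ∙ (u - v))ᗮ.reflection, Submodule.reflection_sub h⟩

theorem RotationallyInvariant.measure_preimage {d : ℕ} {μ : Measure (EuclideanSpace ℝ (Fin d))}
    (hμ : RotationallyInvariant μ)
    (R : EuclideanSpace ℝ (Fin d) ≃ₗᵢ[ℝ] EuclideanSpace ℝ (Fin d))
    (s : Set (EuclideanSpace ℝ (Fin d))) : μ (R ⁻¹' s) = μ s := by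
  conv_rhs => rw [← hμ R]
  exact (R.toHomeomorph.measurableEmbedding.map_apply μ s).symm

/-- The distribution of `(‖x‖, ⟪x, u⟫)` depends on the direction `u` only through its norm. -/
theorem RotationallyInvariant.measure_inner_eq {d : ℕ} {μ : Measure (EuclideanSpace ℝ (Fin d))}
    (hμ : RotationallyInvariant μ) {u v : EuclideanSpace ℝ (Fin d)} (h : ‖u‖ = ‖v‖)
    (p : ℝ → ℝ → Prop) : μ {x | p ‖x‖ (inner ℝ x u)} = μ {x | p ‖x‖ (inner ℝ x v)} := by
  obtain ⟨R, rfl⟩ := exists_linearIsometryEquiv_apply_eq h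
  rw [← hμ.measure_preimage R {x | p ‖x‖ (inner ℝ x (R u))}]
  simp

/-- Signs are sub-Gaussian: the sum factors over coordinates and cosh a ≤ exp(a²/2). -/
theorem sum_bits_exp_le {d : ℕ} (x : Fin d → ℝ) (s : ℝ) :
    ∑ e : Fin d → Bool, Real.exp (s * ∑ l, x l * bitSign (e l)) ≤
      2 ^ d * Real.exp (s ^ 2 * (∑ l, x l ^ 2) / 2) := by
  have h1 : ∀ e : Fin d → Bool, Real.exp (s * ∑ l, x l * bitSign (e l)) =
      ∏ l, Real.exp (s * (x l * bitSign (e l))) := fun e => by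
    rw [Finset.mul_sum, Real.exp_sum]
  simp only [h1]
  rw [← Fintype.piFinset_univ,
    ← Finset.prod_univ_sum (fun _ => Finset.univ) fun l b => Real.exp (s * (x l * bitSign b))]
  have h2 : ∀ l, ∑ b : Bool, Real.exp (s * (x l * bitSign b)) ≤
      2 * Real.exp (s ^ 2 * x l ^ 2 / 2) := by
    intro l
    have h := Real.cosh_le_exp_half_sq (s * x l)
    rw [Real.cosh_eq, mul_pow] at h
    simp only [Fintype.sum_bool, bitSign, if_true, Bool.false_eq_true, if_false, mul_one, mul_neg]
    linarith
  refine (Finset.prod_le_prod (fun l _ => Finset.sum_nonneg fun b _ => (Real.exp_pos _).le)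
    fun l _ => h2 l).trans (le_of_eq ?_)
  rw [Finset.prod_mul_distrib, ← Real.exp_sum, Finset.prod_const, Finset.card_univ,
    Fintype.card_fin, ← Finset.sum_div, ← Finset.mul_sum]

theorem card_bits_cap_le {d : ℕ} (x : EuclideanSpace ℝ (Fin d)) {ρ : ℝ} (hρ : 0 ≤ ρ) :
    ((Finset.univ.filter fun e : Fin d → Bool =>
      ρ * ‖x‖ * √d < ∑ l, x l * bitSign (e l)).card : ℝ) ≤ 2 ^ d * Real.exp (-(ρ ^ 2 * d / 2)) := by
  rcases eq_or_ne x 0 with rfl | hx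
  · simp
    positivity
  have hx' : 0 < ‖x‖ := norm_pos_iff.mpr hx
  -- The optimal Chernoff parameter.
  set s := ρ * √d / ‖x‖ with hs
  have hs0 : 0 ≤ s := by positivity
  have key : ∀ e : Fin d → Bool,
      (if ρ * ‖x‖ * √d < ∑ l, x l * bitSign (e l) then (1 : ℝ) else 0) ≤
      Real.exp (s * ∑ l, x l * bitSign (e l)) * Real.exp (-(s * (ρ * ‖x‖ * √d))) := by
    intro e
    split_ifs with h
    · rw [← Real.exp_add, Real.one_le_exp_iff]
      nlinarith [mul_le_mul_of_nonneg_left h.le hs0]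
    · positivity
  rw [Finset.card_filter]
  push_cast
  refine (Finset.sum_le_sum fun e _ => key e).trans ?_
  rw [← Finset.sum_mul]
  refine (mul_le_mul_of_nonneg_right (sum_bits_exp_le _ _) (Real.exp_pos _).le).trans ?_
  rw [mul_assoc, ← Real.exp_add, ← EuclideanSpace.real_norm_sq_eq]
  refine le_of_eq ?_
  congr 2
  have hd : √(d : ℝ) ^ 2 = d := Real.sq_sqrt (by positivity)
  rw [hs, ← hd]
  field_simp
  simp
  ring

/-- Spherical caps of positive height have exponentially small measure. -/
theorem RotationallyInvariant.measureReal_cap_le {d : ℕ} (hd : 0 < d)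
    {μ : Measure (EuclideanSpace ℝ (Fin d))}
    [IsProbabilityMeasure μ] (hμ : RotationallyInvariant μ) (u : EuclideanSpace ℝ (Fin d))
    {ρ : ℝ} (hρ : 0 ≤ ρ) :
    μ.real {x | ρ * ‖x‖ * ‖u‖ < inner ℝ x u} ≤ Real.exp (-(ρ ^ 2 * d / 2)) := by
  rcases eq_or_ne u 0 with rfl | hu
  · simp
    positivity
  have hu' : 0 < ‖u‖ := norm_pos_iff.mpr hu
  have hd' : (0 : ℝ) < √d := by positivity
  -- All sign vectors have norm √d, so their caps have equal measure. Averaging over them and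
  -- exchanging sum and integral reduces the bound to counting sign vectors for a fixed x.
  let w : (Fin d → Bool) → EuclideanSpace ℝ (Fin d) := fun e => WithLp.toLp 2 fun l => bitSign (e l)
  have hw : ∀ e, ‖w e‖ = √d := by
    intro e
    rw [EuclideanSpace.norm_eq]
    simp [w, bitSign_sq]
  have hin : ∀ x e, inner ℝ x (w e) = ∑ l, x l * bitSign (e l) := by
    intro x e
    simp [w, PiLp.inner_apply, mul_comm]
  let s : (Fin d → Bool) → Set (EuclideanSpace ℝ (Fin d)) := fun e =>
    {x | ρ * ‖x‖ * √d < inner ℝ x (w e)}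
  have hs : ∀ e, MeasurableSet (s e) := fun e =>
    measurableSet_lt (by fun_prop) (by fun_prop)
  have heq : ∀ e, μ.real (s e) = μ.real {x | ρ * ‖x‖ * ‖u‖ < inner ℝ x u} := by
    intro e
    have h := hμ.measure_inner_eq (u := w e) (v := (√d / ‖u‖) • u)
      (by rw [norm_smul, hw, Real.norm_of_nonneg (by positivity)]; field_simp)
      (fun a b => ρ * a * √d < b)
    simp only [Measure.real, s, h]
    congr 2
    ext x
    simp only [Set.mem_ofPred_eq, inner_smul_right]
    rw [div_mul_eq_mul_div, lt_div_iff₀ hu']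
    constructor <;> intro h <;> nlinarith
  have hsum : ∑ e, μ.real (s e) ≤ 2 ^ d * Real.exp (-(ρ ^ 2 * d / 2)) := by
    have h1 : ∀ e, μ.real (s e) = ∫ x, (s e).indicator 1 x ∂μ := fun e =>
      (integral_indicator_one (hs e)).symm
    have hint : ∀ e, Integrable ((s e).indicator (1 : EuclideanSpace ℝ (Fin d) → ℝ)) μ := fun e =>
      (integrable_const (1 : ℝ)).indicator (hs e)
    simp only [h1]
    rw [← integral_finsetSum _ fun e _ => hint e]
    calc _ ≤ ∫ x, (2 ^ d * Real.exp (-(ρ ^ 2 * d / 2)) : ℝ) ∂μ := by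
          refine integral_mono (integrable_finsetSum _ fun e _ => hint e) (integrable_const _) ?_
          intro x
          refine le_trans (le_of_eq ?_) (card_bits_cap_le x hρ)
          rw [Finset.card_filter]
          push_cast
          refine Finset.sum_congr rfl fun e _ => ?_
          simp [Set.indicator_apply, s, hin]
      _ = _ := by simp
  simp only [heq] at hsum
  simp only [Finset.sum_const, Finset.card_univ, Fintype.card_fun, Fintype.card_bool,
      Fintype.card_fin, nsmul_eq_mul, Nat.cast_pow, Nat.cast_ofNat] at hsum
  exact le_of_mul_le_mul_left hsum (by positivity)

/-! ### Gaussian tails and null hyperplanes -/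

open ProbabilityTheory

theorem map_inner_stdGaussian {d : ℕ} (x : EuclideanSpace ℝ (Fin d)) :
    (stdGaussian (EuclideanSpace ℝ (Fin d))).map (fun g => inner ℝ x g) =
      gaussianReal 0 (‖x‖₊ ^ 2) := by
  have h := IsGaussian.map_eq_gaussianReal (μ := stdGaussian (EuclideanSpace ℝ (Fin d)))
    (innerSL ℝ x)
  rw [variance_dual_stdGaussian, integral_strongDual_stdGaussian, innerSL_apply_norm] at h
  convert h using 2
  · ext
    simp
  · rw [← coe_nnnorm, ← NNReal.coe_pow, Real.toNNReal_coe]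

theorem stdGaussian_inner_gt_le {d : ℕ} {x : EuclideanSpace ℝ (Fin d)} (hx : x ≠ 0) {s : ℝ}
    (hs : 0 ≤ s) :
    (stdGaussian (EuclideanSpace ℝ (Fin d))).real {g | s < inner ℝ x g} ≤
      Real.exp (-(s ^ 2 / (2 * ‖x‖ ^ 2))) := by
  have hx' : 0 < ‖x‖ := norm_pos_iff.mpr hx
  have h1 : (stdGaussian (EuclideanSpace ℝ (Fin d))).real {g | s < inner ℝ x g} =
      (gaussianReal 0 (‖x‖₊ ^ 2)).real (Set.Ioi s) := by
    rw [← map_inner_stdGaussian, map_measureReal_apply (by fun_prop) measurableSet_Ioi]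
    rfl
  rw [h1]
  refine (measureReal_mono (Set.Ioi_subset_Ici_self)).trans ?_
  have h2 := measure_ge_le_exp_mul_mgf (μ := gaussianReal 0 (‖x‖₊ ^ 2)) (X := id)
    (t := s / ‖x‖ ^ 2) s (by positivity) (by simpa using integrable_exp_mul_gaussianReal _)
  refine h2.trans (le_of_eq ?_)
  rw [mgf_id_gaussianReal, ← Real.exp_add]
  congr 1
  simp only [NNReal.coe_pow, coe_nnnorm]
  field_simp
  ring

/-- The density on (t, t + 1] is at least its value at t + 1, and √(2π) ≤ 3. -/
theorem le_stdGaussian_inner_gt {d : ℕ} {x : EuclideanSpace ℝ (Fin d)} (hx : x ≠ 0) {t : ℝ}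
    (ht : 0 ≤ t) :
    Real.exp (-((t + 1) ^ 2 / 2)) / 3 ≤
      (stdGaussian (EuclideanSpace ℝ (Fin d))).real {g | t * ‖x‖ < inner ℝ x g} := by
  have hx' : 0 < ‖x‖ := norm_pos_iff.mpr hx
  have h1 : (stdGaussian (EuclideanSpace ℝ (Fin d))).real {g | t * ‖x‖ < inner ℝ x g} =
      (gaussianReal 0 1).real (Set.Ioi t) := by
    have h := map_inner_stdGaussian (‖x‖⁻¹ • x)
    have hn : ‖‖x‖⁻¹ • x‖₊ = 1 := by
      ext
      simp [norm_smul, hx'.ne']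
    rw [hn, one_pow] at h
    rw [← h, map_measureReal_apply (by fun_prop) measurableSet_Ioi]
    congr 1
    ext g
    simp only [Set.mem_ofPred_eq, Set.mem_preimage, Set.mem_Ioi, real_inner_smul_left]
    rw [inv_mul_eq_div, lt_div_iff₀ hx']
  rw [h1]
  refine le_trans ?_ (measureReal_mono (s₁ := Set.Ioc t (t + 1)) fun y hy => hy.1)
  rw [Measure.real, gaussianReal_apply_eq_integral _ one_ne_zero,
    ENNReal.toReal_ofReal (integral_nonneg fun y => gaussianPDFReal_nonneg _ _ _)]
  have hsq : √(2 * Real.pi) ≤ 3 := by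
    rw [Real.sqrt_le_left (by norm_num)]
    nlinarith [Real.pi_lt_d2]
  have h0 : 0 < √(2 * Real.pi) := by positivity
  calc Real.exp (-((t + 1) ^ 2 / 2)) / 3
      = ∫ y in Set.Ioc t (t + 1), Real.exp (-((t + 1) ^ 2 / 2)) / 3 := by simp
    _ ≤ _ := by
      refine setIntegral_mono_on (by simp) (integrable_gaussianPDFReal 0 1).integrableOn
        measurableSet_Ioc fun y hy => ?_
      rw [gaussianPDFReal_def]
      simp only [NNReal.coe_one, mul_one, sub_zero]
      rw [div_eq_inv_mul]
      refine mul_le_mul (inv_anti₀ h0 hsq) (Real.exp_le_exp.mpr ?_) (Real.exp_pos _).le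
        (by positivity)
      have := hy.1
      have := hy.2
      nlinarith

theorem stdGaussian_inner_eq_zero {d : ℕ} {x : EuclideanSpace ℝ (Fin d)} (hx : x ≠ 0) (c : ℝ) :
    stdGaussian (EuclideanSpace ℝ (Fin d)) {g | inner ℝ x g = c} = 0 := by
  have h := map_inner_stdGaussian x
  have hv : ‖x‖₊ ^ 2 ≠ 0 := pow_ne_zero _ (nnnorm_ne_zero_iff.mpr hx)
  have := nullSingletonClass_gaussianReal (μ := 0) hv
  have h2 : (gaussianReal 0 (‖x‖₊ ^ 2)) {c} = 0 := measure_singleton c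
  rw [← h, Measure.map_apply (by fun_prop) (measurableSet_singleton c)] at h2
  exact h2

/-- A rotationally invariant measure without an atom at the origin does not charge hyperplanes. -/
theorem RotationallyInvariant.measure_hyperplane {d : ℕ}
    {μ : Measure (EuclideanSpace ℝ (Fin d))} [IsFiniteMeasure μ] (hμ : RotationallyInvariant μ)
    (h0 : μ {0} = 0) {u : EuclideanSpace ℝ (Fin d)} (hu : u ≠ 0) :
    μ {x | inner ℝ x u = 0} = 0 := by
  set γ := stdGaussian (EuclideanSpace ℝ (Fin d)) with hγ
  have hs : MeasurableSet {z : EuclideanSpace ℝ (Fin d) × EuclideanSpace ℝ (Fin d) |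
      inner ℝ z.2 z.1 = 0} := measurableSet_eq_fun (by fun_prop) (by fun_prop)
  -- Fubini: each nonzero x is almost surely not orthogonal to a Gaussian g, so some nonzero g has a
  -- null hyperplane. Rotation carries this to every u.
  have h1 : (γ.prod μ) {z | inner ℝ z.2 z.1 = 0} = 0 := by
    rw [Measure.prod_apply_symm hs, lintegral_eq_zero_iff (measurable_measure_prodMk_right hs)]
    have : ∀ᵐ x ∂μ, x ≠ 0 := by simpa [ae_iff] using h0
    filter_upwards [this] with x hx
    exact stdGaussian_inner_eq_zero hx 0
  rw [Measure.measure_prod_null hs] at h1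
  have h2 : ∀ᵐ g ∂γ, g ≠ 0 := by
    rw [ae_iff]
    refine measure_mono_null ?_ (stdGaussian_inner_eq_zero hu 0)
    intro g hg
    simp only [ne_eq, not_not, Set.mem_ofPred_eq] at hg ⊢
    simp [hg]
  obtain ⟨g, hg1, hg2⟩ := (h1.and h2).exists
  have hg' : 0 < ‖g‖ := norm_pos_iff.mpr hg2
  have hu' : 0 < ‖u‖ := norm_pos_iff.mpr hu
  have h3 := hμ.measure_inner_eq (u := (‖g‖ / ‖u‖) • u) (v := g)
    (by rw [norm_smul, Real.norm_of_nonneg (by positivity)]; field_simp) (fun _ b => b = 0)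
  have h4 : {x | inner ℝ x ((‖g‖ / ‖u‖) • u) = 0} = {x | inner ℝ x u = 0} := by
    ext x
    simp [inner_smul_right, hg'.ne', hu'.ne']
  rw [← h4, h3]
  exact hg1

/-- For the sum u of the normalized inputs, both events force ⟨u, g⟩ > 2t, while ‖u‖² ≤ 2(1 + ρ).
For small ρ the exponent is almost twice that of a single tail, which is what makes joint selection
rare. -/
theorem stdGaussian_pair_le {d : ℕ} {x x' : EuclideanSpace ℝ (Fin d)} (hx : x ≠ 0) (hx' : x' ≠ 0)
    {ρ t : ℝ} (hρ : 0 ≤ ρ) (ht : 0 ≤ t) (hxx : inner ℝ x x' ≤ ρ * ‖x‖ * ‖x'‖) :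
    (stdGaussian (EuclideanSpace ℝ (Fin d))).real
      {g | t * ‖x‖ < inner ℝ x g ∧ t * ‖x'‖ < inner ℝ x' g} ≤ Real.exp (-(t ^ 2 / (1 + ρ))) := by
  have hn : 0 < ‖x‖ := norm_pos_iff.mpr hx
  have hn' : 0 < ‖x'‖ := norm_pos_iff.mpr hx'
  set u := ‖x‖⁻¹ • x + ‖x'‖⁻¹ • x' with hu
  have hsub : {g | t * ‖x‖ < inner ℝ x g ∧ t * ‖x'‖ < inner ℝ x' g} ⊆ {g | 2 * t < inner ℝ u g} := by
    rintro g ⟨h1, h2⟩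
    simp only [Set.mem_ofPred_eq, hu, inner_add_left, real_inner_smul_left]
    rw [inv_mul_eq_div, inv_mul_eq_div]
    rw [← lt_div_iff₀ hn] at h1
    rw [← lt_div_iff₀ hn'] at h2
    linarith
  refine (measureReal_mono hsub).trans ?_
  rcases eq_or_ne u 0 with h0 | h0
  · have : {g | 2 * t < inner ℝ u g} = ∅ := by
      ext g
      simp [h0, ht]
    rw [this]
    simp
    positivity
  have hun : 0 < ‖u‖ := norm_pos_iff.mpr h0
  have hu2 : ‖u‖ ^ 2 ≤ 2 * (1 + ρ) := by
    rw [hu, norm_add_sq_real, norm_smul, norm_smul, real_inner_smul_left, real_inner_smul_right]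
    simp only [norm_inv, norm_norm, inv_mul_cancel₀ hn.ne', inv_mul_cancel₀ hn'.ne']
    have : ‖x‖⁻¹ * (‖x'‖⁻¹ * inner ℝ x x') ≤ ρ := by
      rw [← mul_assoc, ← mul_inv, inv_mul_le_iff₀ (by positivity)]
      linarith
    linarith
  refine (stdGaussian_inner_gt_le h0 (by linarith)).trans (Real.exp_le_exp.mpr ?_)
  rw [neg_le_neg_iff, div_le_div_iff₀ (by positivity) (by positivity)]
  nlinarith [sq_nonneg t]

/-! ### Collisions under Gaussian routing vectors -/

/-- The region in which exactly the experts in `S` are selected by the routing vectors `r`. -/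
def routingRegion {m d : ℕ} (r : Fin m → EuclideanSpace ℝ (Fin d)) (S : Finset (Fin m)) :
    Set (EuclideanSpace ℝ (Fin d)) :=
  {x | ∀ i ∈ S, ∀ j ∉ S, inner ℝ x (r j) < inner ℝ x (r i)}

/-- The pairs of inputs which are routed to nearly the same `k` experts. -/
def collisionSet {m d : ℕ} (k : ℕ) (ε : ℝ) (r : Fin m → EuclideanSpace ℝ (Fin d)) :
    Set (EuclideanSpace ℝ (Fin d) × EuclideanSpace ℝ (Fin d)) :=
  {z | ∃ S ∈ (Finset.univ : Finset (Fin m)).powersetCard k,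
    ∃ T ∈ (Finset.univ : Finset (Fin m)).powersetCard k, ((S \ T).card : ℝ) ≤ ε * k ∧
      z.1 ∈ routingRegion r S ∧ z.2 ∈ routingRegion r T}

/-- Joint measurability in routing vectors and inputs, for exchanging the two averages. -/
theorem measurableSet_collisionSet {m d k : ℕ} {ε : ℝ} :
    MeasurableSet {q : (Fin m → EuclideanSpace ℝ (Fin d)) ×
      (EuclideanSpace ℝ (Fin d) × EuclideanSpace ℝ (Fin d)) | q.2 ∈ collisionSet k ε q.1} := by
  have h : {q : (Fin m → EuclideanSpace ℝ (Fin d)) ×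
      (EuclideanSpace ℝ (Fin d) × EuclideanSpace ℝ (Fin d)) | q.2 ∈ collisionSet k ε q.1} =
      ⋃ S ∈ (Finset.univ : Finset (Fin m)).powersetCard k,
      ⋃ T ∈ (Finset.univ : Finset (Fin m)).powersetCard k, ⋃ _ : ((S \ T).card : ℝ) ≤ ε * k,
      ((⋂ i ∈ S, ⋂ j ∈ Sᶜ, {q | inner ℝ q.2.1 (q.1 j) < inner ℝ q.2.1 (q.1 i)}) ∩
        ⋂ i ∈ T, ⋂ j ∈ Tᶜ, {q | inner ℝ q.2.2 (q.1 j) < inner ℝ q.2.2 (q.1 i)}) := by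
    ext q
    simp only [collisionSet, routingRegion, Set.mem_ofPred_eq, Set.mem_iUnion, Set.mem_inter_iff,
      Set.mem_iInter, Finset.mem_compl, exists_prop]
  rw [h]
  refine Finset.measurableSet_biUnion _ fun S _ => Finset.measurableSet_biUnion _ fun T _ =>
    MeasurableSet.iUnion fun _ => MeasurableSet.inter ?_ ?_ <;>
  exact Finset.measurableSet_biInter _ fun i _ => Finset.measurableSet_biInter _ fun j _ =>
    measurableSet_lt (by fun_prop) (by fun_prop)

theorem measurableSet_routingRegion {m d : ℕ} (r : Fin m → EuclideanSpace ℝ (Fin d))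
    (S : Finset (Fin m)) : MeasurableSet (routingRegion r S) := by
  have h : routingRegion r S =
      ⋂ i ∈ S, ⋂ j ∈ Sᶜ, {x | inner ℝ x (r j) < inner ℝ x (r i)} := by
    ext x
    simp [routingRegion]
  rw [h]
  exact Finset.measurableSet_biInter _ fun i _ => Finset.measurableSet_biInter _ fun j _ =>
    measurableSet_lt (by fun_prop) (by fun_prop)

/-- With Gaussian routing vectors, two inputs at a large angle rarely collide. -/
theorem gaussian_collision_le {m d k κ : ℕ} {ε ρ t : ℝ} (hρ : 0 ≤ ρ) (ht : 0 ≤ t)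
    (hκ : ∀ n : ℕ, (n : ℝ) ≤ ε * k → κ + n ≤ k) {x x' : EuclideanSpace ℝ (Fin d)}
    (hx : x ≠ 0) (hx' : x' ≠ 0) (hxx : inner ℝ x x' ≤ ρ * ‖x‖ * ‖x'‖) :
    (Measure.pi fun _ : Fin m => stdGaussian (EuclideanSpace ℝ (Fin d))).real
      {r | (x, x') ∈ collisionSet k ε r} ≤
      2 * (m.choose k * (1 - Real.exp (-((t + 1) ^ 2 / 2)) / 3) ^ (m - k)) +
        m.choose κ * Real.exp (-(t ^ 2 / (1 + ρ))) ^ κ := by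
  classical
  set γ := stdGaussian (EuclideanSpace ℝ (Fin d)) with hγ
  set p := Real.exp (-((t + 1) ^ 2 / 2)) / 3 with hp
  set Pr := Measure.pi fun _ : Fin m => γ with hPr
  have hpi : ∀ (s : Finset (Fin m)) (B : Set (EuclideanSpace ℝ (Fin d))),
      Pr.real ((s : Set (Fin m)).pi fun _ => B) = γ.real B ^ s.card := by
    intro s B
    simp [Measure.real, hPr, Measure.pi_pi_finset]
  -- At most k scores exceed t‖y‖. Off this event every selected score does, since a selected score
  -- below the threshold would bound all unselected ones.
  let Low : EuclideanSpace ℝ (Fin d) → Set (Fin m → EuclideanSpace ℝ (Fin d)) := fun y =>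
    ⋃ S ∈ (Finset.univ : Finset (Fin m)).powersetCard k,
      ((Sᶜ : Finset (Fin m)) : Set (Fin m)).pi fun _ => {g | inner ℝ y g ≤ t * ‖y‖}
  have hLow : ∀ y, y ≠ 0 → Pr.real (Low y) ≤ m.choose k * (1 - p) ^ (m - k) := by
    intro y hy
    refine (measureReal_biUnion_finset_le _ _).trans ?_
    have h1 : γ.real {g | inner ℝ y g ≤ t * ‖y‖} ≤ 1 - p := by
      have h2 : {g | inner ℝ y g ≤ t * ‖y‖} = {g | t * ‖y‖ < inner ℝ y g}ᶜ := by
        ext g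
        simp
      rw [h2, measureReal_compl (measurableSet_lt (by fun_prop) (by fun_prop))]
      have := le_stdGaussian_inner_gt hy ht
      simp only [probReal_univ]
      linarith
    have h3 : ∀ S ∈ (Finset.univ : Finset (Fin m)).powersetCard k,
        Pr.real (((Sᶜ : Finset (Fin m)) : Set (Fin m)).pi
          fun _ => {g | inner ℝ y g ≤ t * ‖y‖}) ≤ (1 - p) ^ (m - k) := by
      intro S hS
      rw [hpi, Finset.card_compl, (Finset.mem_powersetCard.mp hS).2, Fintype.card_fin]
      exact pow_le_pow_left₀ measureReal_nonneg h1 _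
    refine (Finset.sum_le_sum h3).trans (le_of_eq ?_)
    simp
  -- Some κ experts score high for both inputs; close selections share at least κ experts.
  let High : Set (Fin m → EuclideanSpace ℝ (Fin d)) :=
    ⋃ Q ∈ (Finset.univ : Finset (Fin m)).powersetCard κ,
      (Q : Set (Fin m)).pi fun _ => {g | t * ‖x‖ < inner ℝ x g ∧ t * ‖x'‖ < inner ℝ x' g}
  have hHigh : Pr.real High ≤ m.choose κ * Real.exp (-(t ^ 2 / (1 + ρ))) ^ κ := by
    refine (measureReal_biUnion_finset_le _ _).trans ?_
    have h3 : ∀ Q ∈ (Finset.univ : Finset (Fin m)).powersetCard κ,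
        Pr.real ((Q : Set (Fin m)).pi
          fun _ => {g | t * ‖x‖ < inner ℝ x g ∧ t * ‖x'‖ < inner ℝ x' g}) ≤
          Real.exp (-(t ^ 2 / (1 + ρ))) ^ κ := by
      intro Q hQ
      rw [hpi, (Finset.mem_powersetCard.mp hQ).2]
      exact pow_le_pow_left₀ measureReal_nonneg (stdGaussian_pair_le hx hx' hρ ht hxx) _
    refine (Finset.sum_le_sum h3).trans (le_of_eq ?_)
    simp
  have hlowmem : ∀ (y : EuclideanSpace ℝ (Fin d)) (r : Fin m → EuclideanSpace ℝ (Fin d)),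
      ∀ S ∈ (Finset.univ : Finset (Fin m)).powersetCard k, y ∈ routingRegion r S →
      r ∉ Low y → ∀ i ∈ S, t * ‖y‖ < inner ℝ y (r i) := by
    intro y r S hS hy hr i hi
    by_contra! hle
    apply hr
    simp only [Low, Set.mem_iUnion]
    refine ⟨S, hS, ?_⟩
    intro j hj
    exact (hy i hi j (by simpa using hj)).le.trans hle
  have hsub : {r | (x, x') ∈ collisionSet k ε r} ⊆ Low x ∪ Low x' ∪ High := by
    rintro r ⟨S, hS, T, hT, hST, h1, h2⟩
    by_cases hl : r ∈ Low x
    · exact Or.inl (Or.inl hl)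
    by_cases hl' : r ∈ Low x'
    · exact Or.inl (Or.inr hl')
    right
    have hc : κ ≤ (S ∩ T).card := by
      have h3 := hκ _ hST
      have h4 := Finset.card_sdiff_add_card_inter S T
      rw [(Finset.mem_powersetCard.mp hS).2] at h4
      omega
    obtain ⟨Q, hQ, hQc⟩ := Finset.exists_subset_card_eq hc
    simp only [High, Set.mem_iUnion]
    refine ⟨Q, Finset.mem_powersetCard.mpr ⟨Finset.subset_univ _, hQc⟩, ?_⟩
    intro i hi
    have := Finset.mem_inter.mp (hQ hi)
    exact ⟨hlowmem x r S hS h1 hl i this.1, hlowmem x' r T hT h2 hl' i this.2⟩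
  have h5 := (measureReal_mono (μ := Pr) hsub).trans
    ((measureReal_union_le _ _).trans (add_le_add (measureReal_union_le _ _) le_rfl))
  have := hLow x hx
  have := hLow x' hx'
  linarith

/-- Two independent Gaussian vectors almost surely differ: given one, equality confines the other to
an affine hyperplane. -/
theorem ae_injective_pi_stdGaussian {m d : ℕ} (hd : 0 < d) :
    (Measure.pi fun _ : Fin m => stdGaussian (EuclideanSpace ℝ (Fin d)))
      {r | ¬ Function.Injective r} = 0 := by
  set γ := stdGaussian (EuclideanSpace ℝ (Fin d)) with hγ
  have hdiag : (γ.prod γ) {z | z.1 = z.2} = 0 := by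
    rw [Measure.measure_prod_null (measurableSet_eq_fun (by fun_prop) (by fun_prop))]
    refine Filter.Eventually.of_forall fun y => ?_
    have hx : EuclideanSpace.single (⟨0, hd⟩ : Fin d) (1 : ℝ) ≠ 0 := by simp
    refine measure_mono_null ?_ (stdGaussian_inner_eq_zero hx
      (inner ℝ (EuclideanSpace.single (⟨0, hd⟩ : Fin d) (1 : ℝ)) y))
    intro z hz
    simp only [Set.mem_preimage, Set.mem_ofPred_eq] at hz ⊢
    rw [hz]
  have hpair : ∀ i j : Fin m, i ≠ j →
      (Measure.pi fun _ : Fin m => γ) {r | r i = r j} = 0 := by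
    intro i j hij
    have h1 : iIndepFun (fun (i : Fin m) (r : Fin m → EuclideanSpace ℝ (Fin d)) => r i)
        (Measure.pi fun _ : Fin m => γ) :=
      iIndepFun_pi (X := fun _ => id) fun _ => aemeasurable_id
    have h2 := (indepFun_iff_map_prod_eq_prod_map_map
      (measurable_pi_apply i).aemeasurable (measurable_pi_apply j).aemeasurable).mp
      (h1.indepFun hij)
    have h3 : ∀ i, (Measure.pi fun _ : Fin m => γ).map (fun r => r i) = γ := fun i =>
      (measurePreserving_eval (fun _ : Fin m => γ) i).map_eq
    rw [h3, h3] at h2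
    rw [← h2, Measure.map_apply (by fun_prop)
      (measurableSet_eq_fun (by fun_prop) (by fun_prop))] at hdiag
    exact hdiag
  have hsub : {r : Fin m → EuclideanSpace ℝ (Fin d) | ¬ Function.Injective r} ⊆
      ⋃ i, ⋃ j, ⋃ _ : i ≠ j, {r | r i = r j} := by
    intro r hr
    simp only [Function.Injective, Set.mem_ofPred_eq, not_forall] at hr
    obtain ⟨i, j, h, hij⟩ := hr
    simp only [Set.mem_iUnion]
    exact ⟨i, j, hij, h⟩
  refine measure_mono_null hsub ?_
  simp only [measure_iUnion_null_iff]
  exact hpair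

/-- If random inputs at a large angle rarely collide under Gaussian routing vectors, then there
are routing vectors for which random inputs rarely collide. -/
theorem RotationallyInvariant.exists_routing_of_gaussian {m d k : ℕ} (hd : 0 < d)
    {μ : Measure (EuclideanSpace ℝ (Fin d))} [IsProbabilityMeasure μ]
    (hμ : RotationallyInvariant μ) (h0 : μ {0} = 0) {ε ρ η : ℝ} (hρ : 0 ≤ ρ) (hη : 0 ≤ η)
    (h : ∀ x x' : EuclideanSpace ℝ (Fin d), x ≠ 0 → x' ≠ 0 →
      inner ℝ x x' ≤ ρ * ‖x‖ * ‖x'‖ →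
      (Measure.pi fun _ : Fin m => stdGaussian (EuclideanSpace ℝ (Fin d))).real
        {r | (x, x') ∈ collisionSet k ε r} ≤ η) :
    ∃ r : Fin m → EuclideanSpace ℝ (Fin d), Function.Injective r ∧
      (μ.prod μ).real (collisionSet k ε r) ≤ η + Real.exp (-(ρ ^ 2 * d / 2)) := by
  set Pr := Measure.pi fun _ : Fin m => stdGaussian (EuclideanSpace ℝ (Fin d)) with hPr
  have hW := measurableSet_collisionSet (m := m) (d := d) (k := k) (ε := ε)
  set W := {q : (Fin m → EuclideanSpace ℝ (Fin d)) ×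
      (EuclideanSpace ℝ (Fin d) × EuclideanSpace ℝ (Fin d)) | q.2 ∈ collisionSet k ε q.1} with hWd
  let cap : Set (EuclideanSpace ℝ (Fin d) × EuclideanSpace ℝ (Fin d)) :=
    {z | ρ * ‖z.1‖ * ‖z.2‖ < inner ℝ z.1 z.2}
  have hcapm : MeasurableSet cap := measurableSet_lt (by fun_prop) (by fun_prop)
  have hcap : (μ.prod μ) cap ≤ ENNReal.ofReal (Real.exp (-(ρ ^ 2 * d / 2))) := by
    rw [Measure.prod_apply_symm hcapm]
    calc _ ≤ ∫⁻ y, ENNReal.ofReal (Real.exp (-(ρ ^ 2 * d / 2))) ∂μ := by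
          refine lintegral_mono fun y => ?_
          rw [← ofReal_measureReal]
          exact ENNReal.ofReal_le_ofReal (hμ.measureReal_cap_le hd y hρ)
      _ = _ := by simp
  have hne : ∀ᵐ z ∂(μ.prod μ), z.1 ≠ 0 ∧ z.2 ≠ 0 := by
    have h1 : ∀ᵐ x ∂μ, x ≠ 0 := by simpa [ae_iff] using h0
    exact (Measure.quasiMeasurePreserving_fst.ae h1).and (Measure.quasiMeasurePreserving_snd.ae h1)
  -- After Tonelli, a pair of inputs contributes at most η unless it lies in the cap, where the
  -- trivial bound 1 is used.
  have hle : ∫⁻ r, (μ.prod μ) (Prod.mk r ⁻¹' W) ∂Pr ≤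
      ENNReal.ofReal (η + Real.exp (-(ρ ^ 2 * d / 2))) := by
    rw [← Measure.prod_apply hW, Measure.prod_apply_symm hW]
    calc _ ≤ ∫⁻ z, (ENNReal.ofReal η + cap.indicator 1 z) ∂(μ.prod μ) := by
          refine lintegral_mono_ae ?_
          filter_upwards [hne] with z hz
          by_cases hc : z ∈ cap
          · rw [Set.indicator_of_mem hc]
            exact prob_le_one.trans le_add_self
          · rw [Set.indicator_of_notMem hc, add_zero, ← ofReal_measureReal]
            exact ENNReal.ofReal_le_ofReal (h z.1 z.2 hz.1 hz.2 (not_lt.mp hc))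
      _ = ENNReal.ofReal η + (μ.prod μ) cap := by
          rw [lintegral_add_left measurable_const, lintegral_indicator_one hcapm]
          simp
      _ ≤ _ := by
          rw [ENNReal.ofReal_add hη (Real.exp_pos _).le]
          gcongr
  -- Some routing does no worse than the average and avoids the null set of non-injective ones.
  obtain ⟨r, hr, hr2⟩ := exists_notMem_null_le_lintegral
    (measurable_measure_prodMk_left (ν := μ.prod μ) hW).aemeasurable
    (ae_injective_pi_stdGaussian (m := m) hd)
  refine ⟨r, by simpa using hr, ?_⟩
  exact ENNReal.toReal_le_of_le_ofReal (by positivity) (hr2.trans hle)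

/-! ### Binomial estimates and counting close sets -/

theorem choose_le_exp {m k : ℕ} (hk : 1 ≤ k) (hkm : k ≤ m) :
    (m.choose k : ℝ) ≤ Real.exp (k * (1 + Real.log (m / k))) := by
  have hk' : (0 : ℝ) < k := by exact_mod_cast hk
  have hm' : (0 : ℝ) < m := by exact_mod_cast hk.trans hkm
  have h1 := Nat.choose_le_pow_div (α := ℝ) k m
  have h2 := Real.pow_div_factorial_le_exp (k : ℝ) hk'.le k
  have hf : (0 : ℝ) < (k.factorial : ℝ) := by exact_mod_cast k.factorial_pos
  rw [mul_add, mul_one, Real.exp_add, Real.exp_nat_mul, Real.exp_log (by positivity)]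
  refine h1.trans ?_
  rw [div_pow, ← mul_div_assoc, le_div_iff₀ (by positivity), div_mul_eq_mul_div,
    div_le_iff₀ hf]
  rw [div_le_iff₀ hf] at h2
  have : (0 : ℝ) < m ^ k := by positivity
  nlinarith

/-- The binomial coefficient is m/k times the one for (m - 1, k - 1), and passing to that pair does
not decrease the ratio when k ≤ m. -/
theorem div_pow_le_choose {m k : ℕ} (hkm : k ≤ m) : ((m : ℝ) / k) ^ k ≤ m.choose k := by
  induction k generalizing m with
  | zero => simp
  | succ k ih =>
    obtain ⟨n, rfl⟩ : ∃ n, m = n + 1 := ⟨m - 1, by omega⟩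
    have h1 := ih (m := n) (by omega)
    have h2 : ((n : ℝ) + 1) * n.choose k = (n + 1).choose (k + 1) * (k + 1) := by
      exact_mod_cast Nat.add_one_mul_choose_eq n k
    have h3 : (((n + 1 : ℕ) : ℝ) / (k + 1 : ℕ)) ^ k ≤ ((n : ℝ) / k) ^ k := by
      rcases Nat.eq_zero_or_pos k with rfl | hk
      · simp
      · refine pow_le_pow_left₀ (by positivity) ?_ _
        have hk' : (0 : ℝ) < k := by exact_mod_cast hk
        have hkn : (k : ℝ) ≤ n := by exact_mod_cast Nat.le_of_succ_le_succ hkm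
        rw [div_le_div_iff₀ (by positivity) hk']
        push_cast
        nlinarith
    have h4 : ((n + 1).choose (k + 1) : ℝ) = ((n + 1 : ℕ) : ℝ) / (k + 1 : ℕ) * n.choose k := by
      push_cast
      field_simp
      linarith
    rw [pow_succ', h4]
    exact mul_le_mul_of_nonneg_left (h3.trans h1) (by positivity)

theorem exp_le_choose {m k : ℕ} (hk : 1 ≤ k) (hkm : k ≤ m) :
    Real.exp (k * Real.log (m / k)) ≤ m.choose k := by
  have hk' : (0 : ℝ) < k := by exact_mod_cast hk
  have hm' : (0 : ℝ) < m := by exact_mod_cast hk.trans hkm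
  rw [Real.exp_nat_mul, Real.exp_log (by positivity)]
  exact div_pow_le_choose hkm

/-- Chernoff counting: weighting subsets by exp(-s|A|) gives total weight (1 + exp(-s))^|S|. -/
theorem card_small_subsets_le {α : Type*} (S : Finset α) {x s : ℝ} (hs : 0 ≤ s) :
    ((S.powerset.filter fun A => (A.card : ℝ) ≤ x).card : ℝ) ≤
      Real.exp (s * x + S.card * Real.exp (-s)) := by
  have key : ∀ A : Finset α, (if (A.card : ℝ) ≤ x then (1 : ℝ) else 0) ≤
      Real.exp (s * x) * (Real.exp (-s) ^ A.card * 1 ^ (S.card - A.card)) := by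
    intro A
    split_ifs with h
    · rw [one_pow, mul_one, ← Real.exp_nat_mul, ← Real.exp_add, Real.one_le_exp_iff]
      nlinarith
    · positivity
  rw [Finset.card_filter]
  push_cast
  refine (Finset.sum_le_sum fun A _ => key A).trans ?_
  rw [← Finset.mul_sum, Finset.sum_pow_mul_eq_add_pow, Real.exp_add, Real.exp_nat_mul]
  gcongr
  exact Real.add_one_le_exp _

/-- The number of `k`-sets close to a given one is a small power of the number of `k`-sets. -/
theorem card_close_sets_le {m k : ℕ} (hk : 1 ≤ k) (hkm : 2 * k ≤ m) (S : Finset (Fin m))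
    (hS : S.card = k) :
    ((((Finset.univ : Finset (Fin m)).powersetCard k).filter fun T =>
      ((S \ T).card : ℝ) ≤ 1 / 10000 * k).card : ℝ) ≤ (m.choose k : ℝ) ^ (0.01 : ℝ) := by
  classical
  have hk' : (0 : ℝ) < k := by exact_mod_cast hk
  have hm' : (2 : ℝ) * k ≤ m := by exact_mod_cast hkm
  set x : ℝ := 1 / 10000 * k with hx
  have hinj : (((Finset.univ : Finset (Fin m)).powersetCard k).filter fun T =>
      ((S \ T).card : ℝ) ≤ x).card ≤
      ((S.powerset.filter fun A => (A.card : ℝ) ≤ x) ×ˢ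
        ((Finset.univ : Finset (Fin m)).powerset.filter fun A => (A.card : ℝ) ≤ x)).card := by
    -- T is recovered from S \ T and T \ S, which have equal small size.
    refine Finset.card_le_card_of_injOn (fun T => (S \ T, T \ S)) ?_ ?_
    · intro T hT
      simp only [Finset.coe_filter, Finset.mem_powersetCard, Finset.subset_univ, true_and,
        Set.mem_ofPred_eq] at hT
      simp only [Finset.coe_product, Set.mem_prod, Finset.coe_filter, Finset.mem_powerset,
        Set.mem_ofPred_eq, Finset.subset_univ, true_and]
      refine ⟨⟨Finset.sdiff_subset, hT.2⟩, ?_⟩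
      rw [← Finset.card_sdiff_comm (hS.trans hT.1.symm)]
      exact hT.2
    · intro T _ T' _ h
      simp only [Prod.mk.injEq] at h
      ext a
      have h1 : a ∈ S \ T ↔ a ∈ S \ T' := by rw [h.1]
      have h2 : a ∈ T \ S ↔ a ∈ T' \ S := by rw [h.2]
      simp only [Finset.mem_sdiff] at h1 h2
      tauto
  -- The Chernoff parameters l and l + L satisfy k exp(-l) = m exp(-(l + L)) = x. The total exponent
  -- is x(2l + L + 2), below kL/100 because L ≥ 0.69.
  set l := Real.log 10000 with hl
  set L := Real.log (m / k) with hL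
  have hl0 : 0 ≤ l := Real.log_nonneg (by norm_num)
  have hl1 : l ≤ 10 := by
    rw [hl, Real.log_le_iff_le_exp (by norm_num)]
    have h1 : Real.exp 10 = Real.exp 1 ^ 10 := by rw [← Real.exp_nat_mul]; norm_num
    have h2 : (2.7 : ℝ) ≤ Real.exp 1 := by linarith [Real.exp_one_gt_d9]
    have h3 := pow_le_pow_left₀ (by norm_num) h2 10
    rw [h1]
    norm_num at h3 ⊢
    linarith
  have hL1 : 0.69 ≤ L := by
    have h2 : Real.log 2 ≤ L :=
      Real.log_le_log (by norm_num) (by rw [le_div_iff₀ hk']; exact hm')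
    linarith [Real.log_two_gt_d9]
  have hel : Real.exp (-l) = 1 / 10000 := by
    rw [Real.exp_neg, hl, Real.exp_log (by norm_num)]
    norm_num
  have hmk : (0 : ℝ) < m / k := div_pos (by linarith) hk'
  have heL : (m : ℝ) * Real.exp (-(l + L)) = x := by
    have hmne : (m : ℝ) ≠ 0 := by linarith
    rw [neg_add, Real.exp_add, hel, Real.exp_neg, hL, Real.exp_log hmk, hx]
    field_simp
  have h1 := card_small_subsets_le S (x := x) hl0
  have h2 := card_small_subsets_le (Finset.univ : Finset (Fin m)) (x := x) (s := l + L)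
    (by linarith)
  rw [hS, hel] at h1
  rw [Finset.card_univ, Fintype.card_fin, heL] at h2
  calc _ ≤ (((S.powerset.filter fun A => (A.card : ℝ) ≤ x) ×ˢ
        ((Finset.univ : Finset (Fin m)).powerset.filter fun A => (A.card : ℝ) ≤ x)).card : ℝ) := by
        exact_mod_cast hinj
    _ ≤ Real.exp (l * x + k * (1 / 10000)) * Real.exp ((l + L) * x + x) := by
        rw [Finset.card_product]
        push_cast
        exact mul_le_mul h1 h2 (by positivity) (Real.exp_pos _).le
    _ ≤ Real.exp (k * L) ^ (0.01 : ℝ) := by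
        rw [← Real.exp_mul, ← Real.exp_add, Real.exp_le_exp, hx]
        nlinarith
    _ ≤ _ := Real.rpow_le_rpow (Real.exp_pos _).le (exp_le_choose hk (by omega)) (by norm_num)

/-! ### Law of the selected set; orthonormal routing -/

theorem routingRegion_disjoint {m d : ℕ} {r : Fin m → EuclideanSpace ℝ (Fin d)}
    {S T : Finset (Fin m)} (hST : S.card = T.card) (hne : S ≠ T) :
    Disjoint (routingRegion r S) (routingRegion r T) :=
  Set.disjoint_left.mpr fun _ hS hT => hne
    (MoE.region_unique (k := 0) (⟨r, 0, 0⟩ : MoE m 0 0 d) hST hS hT)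

theorem sum_measureReal_routingRegion {m d k : ℕ} (μ : Measure (EuclideanSpace ℝ (Fin d)))
    [IsProbabilityMeasure μ] (r : Fin m → EuclideanSpace ℝ (Fin d)) :
    ∑ S ∈ (Finset.univ : Finset (Fin m)).powersetCard k, μ.real (routingRegion r S) =
      μ.real (⋃ S ∈ (Finset.univ : Finset (Fin m)).powersetCard k, routingRegion r S) := by
  refine (measureReal_biUnion_finset ?_ fun S _ => measurableSet_routingRegion r S).symm
  intro S hS T hT hne
  exact routingRegion_disjoint ((Finset.mem_powersetCard_univ.mp hS).trans
    (Finset.mem_powersetCard_univ.mp hT).symm) hne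

open Classical in
theorem measureReal_collisionSet {m d k : ℕ} (μ : Measure (EuclideanSpace ℝ (Fin d)))
    [IsProbabilityMeasure μ] (r : Fin m → EuclideanSpace ℝ (Fin d)) (ε : ℝ) :
    (μ.prod μ).real (collisionSet k ε r) =
      ∑ S ∈ (Finset.univ : Finset (Fin m)).powersetCard k,
      ∑ T ∈ (Finset.univ : Finset (Fin m)).powersetCard k,
        if ((S \ T).card : ℝ) ≤ ε * k then
          μ.real (routingRegion r S) * μ.real (routingRegion r T) else 0 := by
  set P := (Finset.univ : Finset (Fin m)).powersetCard k with hP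
  have h : collisionSet k ε r = ⋃ q ∈ (P ×ˢ P).filter
      (fun q : Finset (Fin m) × Finset (Fin m) => ((q.1 \ q.2).card : ℝ) ≤ ε * k),
      routingRegion r q.1 ×ˢ routingRegion r q.2 := by
    ext z
    simp only [collisionSet, Set.mem_ofPred_eq, Set.mem_iUnion, Finset.mem_filter,
      Finset.mem_product, Set.mem_prod, exists_prop, Prod.exists]
    constructor
    · rintro ⟨S, hS, T, hT, h1, h2, h3⟩
      exact ⟨S, T, ⟨⟨hS, hT⟩, h1⟩, h2, h3⟩
    · rintro ⟨S, T, ⟨⟨hS, hT⟩, h1⟩, h2, h3⟩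
      exact ⟨S, hS, T, hT, h1, h2, h3⟩
  rw [h, measureReal_biUnion_finset]
  · simp only [measureReal_prod_prod]
    rw [Finset.sum_filter, Finset.sum_product]
  · rintro ⟨S, T⟩ h1 ⟨S', T'⟩ h2 hne
    simp only [Finset.coe_filter, Finset.mem_product, Set.mem_ofPred_eq, hP,
      Finset.mem_powersetCard_univ] at h1 h2
    simp only [Function.onFun]
    rw [Set.disjoint_prod]
    by_cases hS : S = S'
    · right
      refine routingRegion_disjoint (h1.1.2.trans h2.1.2.symm) fun hT => hne ?_
      rw [hS, hT]
    · left
      exact routingRegion_disjoint (h1.1.1.trans h2.1.1.symm) hS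
  · exact fun q _ => (measurableSet_routingRegion r _).prod (measurableSet_routingRegion r _)

/-- Orthonormal routing vectors select every `k`-set with the same probability. -/
theorem RotationallyInvariant.measure_routingRegion_basis {m d : ℕ} (hmd : m ≤ d)
    {μ : Measure (EuclideanSpace ℝ (Fin d))} (hμ : RotationallyInvariant μ)
    {S T : Finset (Fin m)} (hST : S.card = T.card) :
    μ (routingRegion (fun i => EuclideanSpace.single (Fin.castLE hmd i) (1 : ℝ)) S) =
      μ (routingRegion (fun i => EuclideanSpace.single (Fin.castLE hmd i) (1 : ℝ)) T) := by
  classical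
  -- A permutation of the experts taking S to T, extended to the coordinates of the space, acts as
  -- an isometry.
  let σ : Equiv.Perm (Fin m) := (Finset.equivOfCardEq hST).extendSubtype
  have hσ : ∀ i, i ∈ S ↔ σ i ∈ T := fun i =>
    ⟨fun h => (Finset.equivOfCardEq hST).extendSubtype_mem i h, fun h => by
      by_contra hn
      exact (Finset.equivOfCardEq hST).extendSubtype_not_mem i hn h⟩
  let τ : Equiv.Perm (Fin d) := σ.viaFintypeEmbedding (Fin.castLEEmb hmd)
  have hτ : ∀ i, τ (Fin.castLE hmd i) = Fin.castLE hmd (σ i) := fun i =>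
    σ.viaFintypeEmbedding_apply_image (Fin.castLEEmb hmd) i
  let R := LinearIsometryEquiv.piLpCongrLeft 2 ℝ ℝ τ
  have hR : ∀ i, R (EuclideanSpace.single (Fin.castLE hmd i) (1 : ℝ)) =
      EuclideanSpace.single (Fin.castLE hmd (σ i)) (1 : ℝ) := by
    intro i
    rw [← hτ]
    exact EuclideanSpace.piLpCongrLeft_single τ _ _
  rw [← hμ.measure_preimage R (routingRegion _ T)]
  congr 1
  ext x
  simp only [routingRegion, Set.mem_preimage, Set.mem_ofPred_eq]
  have hin : ∀ i, inner ℝ (R x) (EuclideanSpace.single (Fin.castLE hmd (σ i)) (1 : ℝ)) =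
      inner ℝ x (EuclideanSpace.single (Fin.castLE hmd i) (1 : ℝ)) := by
    intro i
    rw [← hR, R.inner_map_map]
  constructor
  · intro h i hi j hj
    obtain ⟨i, rfl⟩ := σ.surjective i
    obtain ⟨j, rfl⟩ := σ.surjective j
    rw [hin, hin]
    exact h i ((hσ i).mpr hi) j fun hjS => hj ((hσ j).mp hjS)
  · intro h i hi j hj
    have := h (σ i) ((hσ i).mp hi) (σ j) fun hjT => hj ((hσ j).mpr hjT)
    rwa [hin, hin] at this

/-- Each of the N regions has mass at most 1/N by symmetry, and at most N · N^0.01 pairs are close.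
-/
theorem RotationallyInvariant.exists_routing_of_le {m d k : ℕ} (hk : 1 ≤ k) (hkm : 2 * k ≤ m)
    (hmd : m ≤ d) {μ : Measure (EuclideanSpace ℝ (Fin d))} [IsProbabilityMeasure μ]
    (hμ : RotationallyInvariant μ) :
    ∃ r : Fin m → EuclideanSpace ℝ (Fin d), Function.Injective r ∧
      (μ.prod μ).real (collisionSet k (1 / 10000) r) ≤ (m.choose k : ℝ) ^ (-0.99 : ℝ) := by
  classical
  set r : Fin m → EuclideanSpace ℝ (Fin d) :=
    fun i => EuclideanSpace.single (Fin.castLE hmd i) (1 : ℝ) with hr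
  set P := (Finset.univ : Finset (Fin m)).powersetCard k with hP
  set N : ℝ := (m.choose k : ℝ) with hN
  have hN0 : 0 < N := by
    rw [hN]
    exact_mod_cast Nat.choose_pos (by omega)
  have hcardP : (P.card : ℝ) = N := by simp [hP, hN]
  refine ⟨r, ?_, ?_⟩
  · intro i j hij
    have h1 := congrArg (fun z : EuclideanSpace ℝ (Fin d) => z (Fin.castLE hmd i)) hij
    by_contra hne
    have h2 : Fin.castLE hmd i ≠ Fin.castLE hmd j := fun h => hne (Fin.castLE_injective hmd h)
    simp [hr, h2] at h1
  have hreg : ∀ S ∈ P, μ.real (routingRegion r S) ≤ 1 / N := by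
    intro S hS
    rw [le_div_iff₀ hN0]
    have h1 : ∑ T ∈ P, μ.real (routingRegion r T) ≤ 1 := by
      rw [hP, sum_measureReal_routingRegion]
      exact measureReal_le_one
    have h2 : ∀ T ∈ P, μ.real (routingRegion r T) = μ.real (routingRegion r S) := by
      intro T hT
      rw [Measure.real, hμ.measure_routingRegion_basis hmd
        ((Finset.mem_powersetCard.mp hT).2.trans (Finset.mem_powersetCard.mp hS).2.symm)]
      rfl
    rw [Finset.sum_congr rfl h2, Finset.sum_const, nsmul_eq_mul, hcardP] at h1
    linarith
  rw [measureReal_collisionSet]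
  calc _ ≤ ∑ S ∈ P, ∑ T ∈ P, if ((S \ T).card : ℝ) ≤ 1 / 10000 * k then 1 / N * (1 / N) else 0 := by
        refine Finset.sum_le_sum fun S hS => Finset.sum_le_sum fun T hT => ?_
        split_ifs
        · exact mul_le_mul (hreg S hS) (hreg T hT) measureReal_nonneg (by positivity)
        · exact le_rfl
    _ ≤ ∑ S ∈ P, N ^ (0.01 : ℝ) * (1 / N * (1 / N)) := by
        refine Finset.sum_le_sum fun S hS => ?_
        rw [← Finset.sum_filter, Finset.sum_const, nsmul_eq_mul]
        exact mul_le_mul_of_nonneg_right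
          (card_close_sets_le hk hkm S (Finset.mem_powersetCard.mp hS).2) (by positivity)
    _ = N ^ (0.01 : ℝ) * N⁻¹ := by
        rw [Finset.sum_const, nsmul_eq_mul, hcardP]
        field_simp
    _ = N ^ (-0.99 : ℝ) := by
        rw [← Real.rpow_neg_one N, ← Real.rpow_add hN0]
        norm_num

/-! ### Choice of parameters and existence of good routing -/

/-- The exponent estimate for Gaussian routing vectors when `m / k` is large. -/
theorem gaussian_exponent_le {m k : ℕ} (hk : 1 ≤ k) (hkm : 2 * k ≤ m)
    (hL : 10 ^ 9 ≤ Real.log (m / k)) {t : ℝ}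
    (ht : (t + 1) ^ 2 = 2 * (1 - 1 / 2000) * Real.log (m / k)) (ht0 : 0 ≤ t) {κ : ℕ}
    (hκ : (1 - 1 / 10000) * (k : ℝ) ≤ κ) (hκm : κ ≤ k) :
    2 * ((m.choose k : ℝ) * (1 - Real.exp (-((t + 1) ^ 2 / 2)) / 3) ^ (m - k)) +
        m.choose κ * Real.exp (-(t ^ 2 / (1 + 1 / 2000))) ^ κ ≤
      2 / 3 * Real.exp (-(0.99 * (k * (1 + Real.log (m / k))))) := by
  set L := Real.log (m / k) with hLdef
  have hk1 : (1 : ℝ) ≤ k := by exact_mod_cast hk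
  have hk' : (0 : ℝ) < k := by linarith
  have hm' : (2 : ℝ) * k ≤ m := by exact_mod_cast hkm
  have he2 : Real.exp (-2) ≤ 1 / 6 := by
    have h2 : (2.5 : ℝ) ≤ Real.exp 1 := by linarith [Real.exp_one_gt_d9]
    have h1 : Real.exp 2 = Real.exp 1 ^ 2 := by rw [← Real.exp_nat_mul]; norm_num
    rw [Real.exp_neg, h1, inv_le_comm₀ (by positivity) (by norm_num)]
    nlinarith
  -- The three terms use at most 3 · 1/6 of the target; a further third is kept for the cap bound.
  have hthird : ∀ u : ℝ, u ≤ -(0.99 * (k * (1 + L))) - 2 →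
      Real.exp u ≤ 1 / 6 * Real.exp (-(0.99 * (k * (1 + L)))) := by
    intro u hu
    refine (Real.exp_le_exp.mpr hu).trans ?_
    rw [sub_eq_add_neg, Real.exp_add, mul_comm]
    gcongr
  have hmk : (0 : ℝ) < m / k := div_pos (by linarith) hk'
  have hfirst : (m.choose k : ℝ) * (1 - Real.exp (-((t + 1) ^ 2 / 2)) / 3) ^ (m - k) ≤
      1 / 6 * Real.exp (-(0.99 * (k * (1 + L)))) := by
    set p := Real.exp (-((t + 1) ^ 2 / 2)) / 3 with hp
    have hp0 : 0 ≤ p := by positivity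
    have hp1 : p ≤ 1 := by
      have : Real.exp (-((t + 1) ^ 2 / 2)) ≤ 1 := Real.exp_le_one_iff.mpr (by
        have := sq_nonneg (t + 1)
        linarith)
      rw [hp]
      linarith
    have h1 : (1 - p) ^ (m - k) ≤ Real.exp (-(p * (m / 2))) := by
      refine (pow_le_pow_left₀ (by linarith) (Real.one_sub_le_exp_neg p) _).trans ?_
      rw [← Real.exp_nat_mul, Real.exp_le_exp, Nat.cast_sub (by omega)]
      nlinarith
    -- The threshold lies slightly below the typical k-th score: the expected number of higher
    -- scores is at least k exp(L/2000)/3, whose exponential beats the entropy k(1 + L).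
    have h2 : p * (m / 2) = k * (Real.exp (L / 2000) / 6) := by
      have hm2 : (m : ℝ) = k * Real.exp L := by
        rw [hLdef, Real.exp_log hmk]
        field_simp
      have h3 : Real.exp (-((t + 1) ^ 2 / 2)) * Real.exp L = Real.exp (L / 2000) := by
        rw [← Real.exp_add, ht]
        congr 1
        ring
      rw [hp, hm2, ← h3]
      ring
    have h4 : 24 + 12 * L ≤ Real.exp (L / 2000) := by
      have := Real.quadratic_le_exp_of_nonneg (x := L / 2000) (by linarith)
      nlinarith
    calc _ ≤ Real.exp (k * (1 + L)) * Real.exp (-(p * (m / 2))) :=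
          mul_le_mul (choose_le_exp hk (by omega)) h1 (pow_nonneg (by linarith) _)
            (Real.exp_pos _).le
      _ ≤ _ := by
          rw [← Real.exp_add, h2]
          apply hthird
          nlinarith
  have hsecond : (m.choose κ : ℝ) * Real.exp (-(t ^ 2 / (1 + 1 / 2000))) ^ κ ≤
      1 / 6 * Real.exp (-(0.99 * (k * (1 + L)))) := by
    have hκ0 : (0 : ℝ) < κ := by linarith
    have hκ1 : 1 ≤ κ := by exact_mod_cast hκ0
    have hκk : (κ : ℝ) ≤ k := by exact_mod_cast hκm
    have h1 := choose_le_exp (m := m) hκ1 (by omega)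
    have h2 : Real.log (m / κ) ≤ L + 1 := by
      have h3 : (m : ℝ) / κ ≤ m / k * 2 := by
        rw [div_mul_eq_mul_div, div_le_div_iff₀ hκ0 hk']
        nlinarith
      refine (Real.log_le_log (div_pos (by linarith) hκ0) h3).trans ?_
      rw [Real.log_mul hmk.ne' (by norm_num)]
      linarith [Real.log_two_lt_d9]
    -- Against the entropy κ(2 + L) this leaves about -0.996 kL; since L ≥ 10⁹, the margin over 0.99
    -- absorbs the lower-order terms.
    have h4 : 1.996 * L ≤ t ^ 2 / (1 + 1 / 2000) := by
      rw [le_div_iff₀ (by norm_num)]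
      have h5 : 4000 ≤ t + 1 := by
        by_contra! h
        nlinarith
      nlinarith
    calc _ ≤ Real.exp (κ * (2 + L)) * Real.exp (-(1.996 * L)) ^ κ := by
          refine mul_le_mul (h1.trans (Real.exp_le_exp.mpr ?_)) ?_ (by positivity)
            (Real.exp_pos _).le
          · nlinarith
          · gcongr
      _ ≤ _ := by
          rw [← Real.exp_nat_mul, ← Real.exp_add]
          apply hthird
          nlinarith
  linarith [Real.exp_pos (-(0.99 * (k * (1 + L))))]

/-- Routing vectors for which random inputs are rarely routed to nearly the same experts. -/
theorem RotationallyInvariant.exists_routing {m d k : ℕ} (hk : 1 ≤ k) (hkm : 2 * k ≤ m)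
    (hd : 4 * Real.exp (10 ^ 9) * k * Real.log m ^ 2 ≤ d)
    {μ : Measure (EuclideanSpace ℝ (Fin d))} [IsProbabilityMeasure μ]
    (hμ : RotationallyInvariant μ) (h0 : μ {0} = 0) :
    ∃ r : Fin m → EuclideanSpace ℝ (Fin d), Function.Injective r ∧
      (μ.prod μ).real (collisionSet k (1 / 10000) r) ≤ (m.choose k : ℝ) ^ (-0.99 : ℝ) := by
  rcases le_or_gt m d with hmd | hmd
  · exact hμ.exists_routing_of_le hk hkm hmd
  have hk1 : (1 : ℝ) ≤ k := by exact_mod_cast hk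
  have hk' : (0 : ℝ) < k := by linarith
  have hm' : (2 : ℝ) * k ≤ m := by exact_mod_cast hkm
  have hlm : 0.69 ≤ Real.log m := by
    have : Real.log 2 ≤ Real.log m := Real.log_le_log (by norm_num) (by linarith)
    linarith [Real.log_two_gt_d9]
  set K := Real.exp (10 ^ 9) with hK
  have hK0 : 0 < K := Real.exp_pos _
  -- Here m > d ≥ 4Kk (log m)², and 4 · 0.69² ≥ 1. The constant K = exp(10⁹) thus makes log(m/k) at
  -- least 10⁹.
  have hmk : K * k ≤ m := by
    have h1 : (d : ℝ) < m := by exact_mod_cast hmd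
    have h2 : 1 ≤ 4 * Real.log m ^ 2 := by nlinarith
    nlinarith [mul_le_mul_of_nonneg_left h2 (mul_pos hK0 hk').le]
  have hL : 10 ^ 9 ≤ Real.log (m / k) := by
    rw [Real.le_log_iff_exp_le (div_pos (by linarith) hk'), le_div_iff₀ hk']
    exact hmk
  set L := Real.log (m / k) with hLdef
  have hLm : L ≤ Real.log m := by
    refine Real.log_le_log (div_pos (by linarith) hk') (div_le_self (by linarith) hk1)
  have hd0 : 0 < d := by
    have : (0 : ℝ) < d := lt_of_lt_of_le (by positivity) hd
    exact_mod_cast this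
  have hdL : 10 ^ 9 * (k * L) ≤ d := by
    have h1 : (10 : ℝ) ^ 9 ≤ K := by
      have := Real.add_one_le_exp ((10 : ℝ) ^ 9)
      linarith
    have h2 : L ≤ Real.log m ^ 2 := by nlinarith
    calc (10 : ℝ) ^ 9 * (k * L) ≤ K * (k * Real.log m ^ 2) := by gcongr
      _ ≤ 4 * K * k * Real.log m ^ 2 := by
        have : 0 ≤ K * (k * Real.log m ^ 2) := by positivity
        nlinarith
      _ ≤ d := hd
  set t := √(2 * (1 - 1 / 2000) * L) - 1 with ht
  have hL0 : (0 : ℝ) ≤ 2 * (1 - 1 / 2000) * L := by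
    norm_num
    linarith
  have ht0 : 0 ≤ t := by
    rw [ht, sub_nonneg, Real.one_le_sqrt]
    norm_num
    linarith
  have ht1 : (t + 1) ^ 2 = 2 * (1 - 1 / 2000) * L := by
    rw [ht, sub_add_cancel, Real.sq_sqrt hL0]
  set κ := k - ⌊1 / 10000 * (k : ℝ)⌋₊ with hκ
  have hfl : (⌊1 / 10000 * (k : ℝ)⌋₊ : ℝ) ≤ 1 / 10000 * k := Nat.floor_le (by positivity)
  have hflk : ⌊1 / 10000 * (k : ℝ)⌋₊ ≤ k := by
    have : (⌊1 / 10000 * (k : ℝ)⌋₊ : ℝ) ≤ k := by linarith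
    exact_mod_cast this
  have hκ1 : (1 - 1 / 10000) * (k : ℝ) ≤ κ := by
    rw [hκ, Nat.cast_sub hflk]
    linarith
  have hκ2 : ∀ n : ℕ, (n : ℝ) ≤ 1 / 10000 * k → κ + n ≤ k := by
    intro n hn
    have := Nat.le_floor hn
    omega
  have hexp := gaussian_exponent_le hk hkm hL ht1 ht0 hκ1 (Nat.sub_le _ _)
  obtain ⟨r, hr, hr2⟩ := hμ.exists_routing_of_gaussian (m := m) (k := k) hd0 h0
    (ε := 1 / 10000) (ρ := 1 / 2000)
    (η := 2 / 3 * Real.exp (-(0.99 * (k * (1 + L))))) (by norm_num) (by positivity)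
    fun x x' hx hx' hxx =>
      (gaussian_collision_le (by norm_num) ht0 hκ2 hx hx' hxx).trans hexp
  refine ⟨r, hr, hr2.trans ?_⟩
  -- With ρ = 1/2000 the cap exponent is d/(8 · 10⁶) ≥ 125 kL.
  have h3 : Real.exp (-((1 / 2000) ^ 2 * d / 2)) ≤ 1 / 3 * Real.exp (-(0.99 * (k * (1 + L)))) := by
    have h4 : Real.exp (-2) ≤ 1 / 3 := by
      have h2 : (2.5 : ℝ) ≤ Real.exp 1 := by linarith [Real.exp_one_gt_d9]
      have h1 : Real.exp 2 = Real.exp 1 ^ 2 := by rw [← Real.exp_nat_mul]; norm_num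
      rw [Real.exp_neg, h1, inv_le_comm₀ (by positivity) (by norm_num)]
      nlinarith
    calc _ ≤ Real.exp (-2 + -(0.99 * (k * (1 + L)))) := by
          rw [Real.exp_le_exp]
          nlinarith
      _ ≤ _ := by
          rw [Real.exp_add]
          gcongr
  have h5 : Real.exp (-(0.99 * (k * (1 + L)))) ≤ (m.choose k : ℝ) ^ (-0.99 : ℝ) := by
    have h6 : (0 : ℝ) < m.choose k := by exact_mod_cast Nat.choose_pos (by omega)
    have h7 := Real.rpow_le_rpow_of_nonpos h6 (choose_le_exp hk (by omega : k ≤ m))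
      (by norm_num : (-0.99 : ℝ) ≤ 0)
    rw [← Real.exp_mul] at h7
    refine le_trans (le_of_eq ?_) h7
    congr 1
    ring
  linarith

/-! ### Almost every input is routed -/

/-- Inputs with pairwise distinct scores are routed to some `k` experts. -/
theorem exists_mem_routingRegion {m d k : ℕ} (hkm : k ≤ m)
    {r : Fin m → EuclideanSpace ℝ (Fin d)} {x : EuclideanSpace ℝ (Fin d)}
    (hx : Function.Injective fun i => inner ℝ x (r i)) :
    ∃ S ∈ (Finset.univ : Finset (Fin m)).powersetCard k, x ∈ routingRegion r S := by
  induction k with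
  | zero => exact ⟨∅, by simp, fun i hi => by simp at hi⟩
  | succ k ih =>
    obtain ⟨S, hS, hxS⟩ := ih (by omega)
    rw [Finset.mem_powersetCard_univ] at hS
    have hne : Sᶜ.Nonempty := by
      rw [← Finset.card_pos, Finset.card_compl, hS, Fintype.card_fin]
      omega
    -- Greedy selection: the best remaining expert is added; distinct scores make the comparison
    -- strict.
    obtain ⟨i₀, hi₀, hmax⟩ := Finset.exists_max_image Sᶜ (fun i => inner ℝ x (r i)) hne
    rw [Finset.mem_compl] at hi₀
    refine ⟨insert i₀ S, by simp [Finset.card_insert_of_notMem hi₀, hS], ?_⟩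
    intro i hi j hj
    rw [Finset.mem_insert, not_or] at hj
    rcases Finset.mem_insert.mp hi with rfl | hi
    · exact lt_of_le_of_ne (hmax j (Finset.mem_compl.mpr hj.2)) fun h => hj.1 (hx h)
    · exact hxS i hi j hj.2

/-- Ties lie in the finitely many null hyperplanes orthogonal to differences of routing vectors. -/
theorem RotationallyInvariant.ae_mem_routingRegion {m d k : ℕ} (hkm : k ≤ m)
    {μ : Measure (EuclideanSpace ℝ (Fin d))} [IsFiniteMeasure μ]
    (hμ : RotationallyInvariant μ) (h0 : μ {0} = 0)
    {r : Fin m → EuclideanSpace ℝ (Fin d)} (hr : Function.Injective r) :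
    ∀ᵐ x ∂μ, ∃ S ∈ (Finset.univ : Finset (Fin m)).powersetCard k, x ∈ routingRegion r S := by
  have h1 : ∀ᵐ x ∂μ, ∀ i j, i ≠ j → inner ℝ x (r i - r j) ≠ 0 := by
    rw [ae_all_iff]
    intro i
    rw [ae_all_iff]
    intro j
    by_cases hij : i = j
    · simp [hij]
    · simpa [ae_iff, hij] using hμ.measure_hyperplane h0 (sub_ne_zero.mpr (hr.ne hij))
  filter_upwards [h1] with x hx
  refine exists_mem_routingRegion hkm fun i j hij => ?_
  by_contra hne
  apply hx i j hne
  rw [inner_sub_right]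
  exact sub_eq_zero.mpr hij

/-! ### Models with constant activation as step functions -/

namespace MoE

variable {m k w d : ℕ}

theorem measurable_eval_constActivation (f : MoE m k w d) :
    Measurable fun x => f.eval constActivation x := by
  classical
  unfold eval
  refine Finset.measurable_sum _ fun S _ => ?_
  -- The output of an expert does not depend on the input here, so its value at `0` stands for all.
  exact Measurable.ite (measurableSet_routingRegion f.routing S)
    (measurable_const (a := ∑ j ∈ S, f.expert constActivation j 0)) measurable_const

theorem norm_eval_constActivation_le (f : MoE m k w d) (x : EuclideanSpace ℝ (Fin d)) :
    ‖f.eval constActivation x‖ ≤ ∑ S ∈ (Finset.univ : Finset (Fin m)).powersetCard k,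
      ‖∑ j ∈ S, f.expert constActivation j 0‖ := by
  unfold eval
  refine (norm_sum_le _ _).trans (Finset.sum_le_sum fun S _ => ?_)
  split_ifs
  · exact le_rfl
  · simp

theorem integrable_norm_sub_sq {m' k' w' : ℕ} (f : MoE m k w d) (f' : MoE m' k' w' d)
    (μ : Measure (EuclideanSpace ℝ (Fin d))) [IsFiniteMeasure μ] :
    Integrable (fun x => ‖f.eval constActivation x - f'.eval constActivation x‖ ^ 2) μ := by
  refine Integrable.of_bound
    ((f.measurable_eval_constActivation.sub
      f'.measurable_eval_constActivation).norm.pow_const 2).aestronglyMeasurable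
    ((∑ S ∈ (Finset.univ : Finset (Fin m)).powersetCard k,
      ‖∑ j ∈ S, f.expert constActivation j 0‖ +
      ∑ S ∈ (Finset.univ : Finset (Fin m')).powersetCard k',
      ‖∑ j ∈ S, f'.expert constActivation j 0‖) ^ 2) (Filter.Eventually.of_forall fun x => ?_)
  rw [Real.norm_of_nonneg (sq_nonneg _)]
  exact pow_le_pow_left₀ (norm_nonneg _) ((norm_sub_le _ _).trans
    (add_le_add (f.norm_eval_constActivation_le x) (f'.norm_eval_constActivation_le x))) 2

/-- With constant activation a model takes at most `m.choose k + 1` values. -/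
theorem exists_finset_eval_mem (f : MoE m k w d) :
    ∃ Y : Finset (EuclideanSpace ℝ (Fin d)), Y.card ≤ m.choose k + 1 ∧
      ∀ x, f.eval constActivation x ∈ Y := by
  classical
  -- The extra value 0 is taken at inputs outside all regions.
  refine ⟨insert 0 (((Finset.univ : Finset (Fin m)).powersetCard k).image
    fun S => ∑ j ∈ S, f.expert constActivation j 0), ?_, ?_⟩
  · refine (Finset.card_insert_le _ _).trans (Nat.succ_le_succ (Finset.card_image_le.trans ?_))
    simp
  · intro x
    by_cases h : ∃ S : Finset (Fin m), S.card = k ∧ x ∈ f.region S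
    · obtain ⟨S, hS, hx⟩ := h
      rw [f.eval_of_mem _ hS hx]
      exact Finset.mem_insert_of_mem (Finset.mem_image.mpr
        ⟨S, Finset.mem_powersetCard_univ.mpr hS, rfl⟩)
    · push Not at h
      rw [f.eval_of_notMem _ h]
      exact Finset.mem_insert_self _ _

/-- All scores tie at the origin, so no region of a nonempty proper subset contains it. Hence an
atom at 0 adds nothing to the mean square of the model. -/
theorem eval_zero (f : MoE m k w d) (σ : ℝ → ℝ) (hk : 1 ≤ k) (hkm : k < m) :
    f.eval σ 0 = 0 := by
  refine f.eval_of_notMem σ fun S hS h => ?_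
  obtain ⟨i, hi⟩ := Finset.card_pos.mp (by omega : 0 < S.card)
  obtain ⟨j, hj⟩ := Finset.card_pos.mp
    (by rw [Finset.card_compl, Fintype.card_fin]; omega : 0 < Sᶜ.card)
  simpa using h i hi j (Finset.mem_compl.mp hj)

/-- The model with routing vectors `r` whose experts output the constants `v` under constant
activation. -/
def ofVectors (k w : ℕ) (r v : Fin m → EuclideanSpace ℝ (Fin d)) : MoE m k w d where
  routing := r
  A := fun j => Matrix.of fun i l => if (l : ℕ) = 0 then v j i else 0
  B := 0

theorem eval_ofVectors (hw : 1 ≤ w) (r v : Fin m → EuclideanSpace ℝ (Fin d))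
    {S : Finset (Fin m)} (hS : S.card = k) {x : EuclideanSpace ℝ (Fin d)}
    (hx : x ∈ routingRegion r S) :
    (ofVectors k w r v).eval constActivation x = ∑ j ∈ S, v j := by
  rw [eval_of_mem _ _ hS hx]
  refine Finset.sum_congr rfl fun j _ => ?_
  obtain ⟨w, rfl⟩ : ∃ n, w = n + 1 := ⟨w - 1, by omega⟩
  ext i
  simp [expert, ofVectors, constActivation, Matrix.mulVec, dotProduct]

/-- The integrand depends almost surely only on the selected set and the value of h. The case h = 0
gives the mean square of the model, the case of a competitor its error. -/
theorem integral_norm_ofVectors_sub_sq (hw : 1 ≤ w) {μ : Measure (EuclideanSpace ℝ (Fin d))}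
    [IsProbabilityMeasure μ] (r v : Fin m → EuclideanSpace ℝ (Fin d))
    (hae : ∀ᵐ x ∂μ, ∃ S ∈ (Finset.univ : Finset (Fin m)).powersetCard k, x ∈ routingRegion r S)
    {h : EuclideanSpace ℝ (Fin d) → EuclideanSpace ℝ (Fin d)} (hm : Measurable h)
    {Y : Finset (EuclideanSpace ℝ (Fin d))} (hY : ∀ x, h x ∈ Y) :
    ∫ x, ‖(ofVectors k w r v).eval constActivation x - h x‖ ^ 2 ∂μ =
      ∑ S ∈ (Finset.univ : Finset (Fin m)).powersetCard k, ∑ y ∈ Y,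
        μ.real (routingRegion r S ∩ h ⁻¹' {y}) * ‖∑ j ∈ S, v j - y‖ ^ 2 := by
  classical
  have hms : ∀ S y, MeasurableSet (routingRegion r S ∩ h ⁻¹' {y}) := fun S y =>
    (measurableSet_routingRegion r S).inter (hm (measurableSet_singleton y))
  have hint : ∀ (S : Finset (Fin m)) (y : EuclideanSpace ℝ (Fin d)),
      Integrable ((routingRegion r S ∩ h ⁻¹' {y}).indicator
        fun _ => ‖∑ j ∈ S, v j - y‖ ^ 2) μ := fun S y =>
    (integrable_const _).indicator (hms S y)
  have hcongr : (fun x => ‖(ofVectors k w r v).eval constActivation x - h x‖ ^ 2) =ᵐ[μ]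
      fun x => ∑ S ∈ (Finset.univ : Finset (Fin m)).powersetCard k, ∑ y ∈ Y,
        (routingRegion r S ∩ h ⁻¹' {y}).indicator (fun _ => ‖∑ j ∈ S, v j - y‖ ^ 2) x := by
    filter_upwards [hae] with x hx
    obtain ⟨S, hS, hxS⟩ := hx
    rw [Finset.sum_eq_single_of_mem S hS, Finset.sum_eq_single_of_mem (h x) (hY x)]
    · rw [eval_ofVectors hw r v (Finset.mem_powersetCard_univ.mp hS) hxS]
      exact (Set.indicator_of_mem (s := routingRegion r S ∩ h ⁻¹' {h x})
        (Set.mem_inter hxS rfl) fun _ => ‖∑ j ∈ S, v j - h x‖ ^ 2).symm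
    · intro y _ hy
      exact Set.indicator_of_notMem (fun hc => hy hc.2.symm) _
    · intro T hT hne
      refine Finset.sum_eq_zero fun y _ => Set.indicator_of_notMem (fun hc => ?_) _
      exact Set.disjoint_left.mp (routingRegion_disjoint
        ((Finset.mem_powersetCard_univ.mp hT).trans (Finset.mem_powersetCard_univ.mp hS).symm) hne)
        hc.1 hxS
  rw [integral_congr_ae hcongr,
    integral_finsetSum _ fun S _ => integrable_finsetSum _ fun y _ => hint S y]
  refine Finset.sum_congr rfl fun S _ => ?_
  rw [integral_finsetSum _ fun y _ => hint S y]
  refine Finset.sum_congr rfl fun y _ => ?_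
  rw [integral_indicator_const _ (hms S y), smul_eq_mul]

end MoE

/-! ### Assembly of the hard model -/

/-- Pays for the union bound over pairs of k-sets: 0.07 d ≥ 7k log m outweighs the 2k log m from N².
-/
theorem choose_sq_mul_pow_le {m k d : ℕ} (hk : 1 ≤ k) (hkm : 2 * k ≤ m)
    (hd : 4 * Real.exp (10 ^ 9) * k * Real.log m ^ 2 ≤ d) :
    (m.choose k : ℝ) ^ 2 * (93 / 100 : ℝ) ^ d ≤ 1 / 4 := by
  have hk1 : (1 : ℝ) ≤ k := by exact_mod_cast hk
  have hm' : (2 : ℝ) * k ≤ m := by exact_mod_cast hkm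
  have hlm : 0.69 ≤ Real.log m := by
    have : Real.log 2 ≤ Real.log m := Real.log_le_log (by norm_num) (by linarith)
    linarith [Real.log_two_gt_d9]
  have h1 : (m.choose k : ℝ) ≤ Real.exp (k * Real.log m) := by
    rw [Real.exp_nat_mul, Real.exp_log (by linarith)]
    exact_mod_cast Nat.choose_le_pow m k
  have h2 : (93 / 100 : ℝ) ^ d ≤ Real.exp (-(0.07 * d)) := by
    refine (pow_le_pow_left₀ (by norm_num)
      (le_trans (by norm_num) (Real.one_sub_le_exp_neg 0.07)) d).trans (le_of_eq ?_)
    rw [← Real.exp_nat_mul]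
    congr 1
    ring
  have h3 : Real.exp (-2) ≤ 1 / 4 := by
    have h4 : (2.5 : ℝ) ≤ Real.exp 1 := by linarith [Real.exp_one_gt_d9]
    have h5 : Real.exp 2 = Real.exp 1 ^ 2 := by rw [← Real.exp_nat_mul]; norm_num
    rw [Real.exp_neg, h5, inv_le_comm₀ (by positivity) (by norm_num)]
    nlinarith
  have h6 : 100 * (k * Real.log m) ≤ d := by
    have h7 : (10 : ℝ) ^ 9 ≤ Real.exp (10 ^ 9) := by
      have := Real.add_one_le_exp ((10 : ℝ) ^ 9)
      linarith
    have h8 : (0 : ℝ) ≤ k * Real.log m ^ 2 := by positivity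
    have h9 : (k : ℝ) * Real.log m ≤ 2 * (k * Real.log m ^ 2) := by
      nlinarith [mul_nonneg (by linarith : (0 : ℝ) ≤ k) (by linarith : 0 ≤ Real.log m)]
    nlinarith [mul_le_mul_of_nonneg_right h7 h8]
  calc _ ≤ Real.exp (k * Real.log m) ^ 2 * Real.exp (-(0.07 * d)) := by gcongr
    _ = Real.exp (2 * (k * Real.log m) + -(0.07 * d)) := by
        rw [Real.exp_add, ← Real.exp_nat_mul]
        norm_num
    _ ≤ Real.exp (-2) := by
        rw [Real.exp_le_exp]
        nlinarith
    _ ≤ _ := h3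

/-- Granularity separation for rotationally invariant measures without an atom at the origin. -/
theorem RotationallyInvariant.exists_hard_model {m k w d m' k' : ℕ}
    {μ : Measure (EuclideanSpace ℝ (Fin d))} [IsProbabilityMeasure μ]
    (hμ : RotationallyInvariant μ) (h0 : μ {0} = 0) (hk : 1 ≤ k) (hw : 1 ≤ w)
    (hd : 4 * Real.exp (10 ^ 9) * k * Real.log m ^ 2 ≤ d) (hkm : 2 * k ≤ m)
    (hN : (m'.choose k' : ℝ) < 1 / 1000000 * (m.choose k : ℝ) ^ (0.99 : ℝ)) :
    ∃ f : MoE m k w d, Function.Injective f.routing ∧ ∀ (w' : ℕ) (f' : MoE m' k' w' d),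
      1 / 1000000 * ∫ x, ‖f.eval constActivation x‖ ^ 2 ∂μ <
        ∫ x, ‖f.eval constActivation x - f'.eval constActivation x‖ ^ 2 ∂μ := by
  classical
  have hk1 : (1 : ℝ) ≤ k := by exact_mod_cast hk
  have hd0 : 0 < d := by
    have hm : (1 : ℝ) < m := by exact_mod_cast (by omega : 1 < m)
    have : 0 < Real.log m := Real.log_pos hm
    have : (0 : ℝ) < d := lt_of_lt_of_le (by positivity) hd
    exact_mod_cast this
  have hd0' : (0 : ℝ) < d := by exact_mod_cast hd0
  obtain ⟨r, hr, hcol⟩ := hμ.exists_routing hk hkm hd h0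
  have hae := hμ.ae_mem_routingRegion (k := k) (by omega) h0 hr
  set P := (Finset.univ : Finset (Fin m)).powersetCard k with hP
  have hsum : ∑ S ∈ P, μ.real (routingRegion r S) = 1 := by
    rw [hP, sum_measureReal_routingRegion, ← probReal_univ (μ := μ)]
    refine measureReal_congr (Filter.eventuallyEq_set.mpr ?_)
    filter_upwards [hae] with x hx
    simpa [hP] using hx
  have hnorm : ∀ v : Fin m → EuclideanSpace ℝ (Fin d),
      ∫ x, ‖(MoE.ofVectors k w r v).eval constActivation x‖ ^ 2 ∂μ =
        ∑ S ∈ P, μ.real (routingRegion r S) * ‖∑ j ∈ S, v j‖ ^ 2 := by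
    intro v
    have := MoE.integral_norm_ofVectors_sub_sq hw r v hae (h := fun _ => 0) (Y := {0})
      measurable_const (fun _ => by simp)
    simpa using this
  -- With no admissible set the competitor vanishes, and any nonzero f suffices. Otherwise N' ≥ 1,
  -- so N' + 1 ≤ 2N' absorbs the extra value.
  rcases Nat.eq_zero_or_pos (m'.choose k') with hN' | hN'
  · let v : Fin m → EuclideanSpace ℝ (Fin d) := fun _ => EuclideanSpace.single ⟨0, hd0⟩ 1
    refine ⟨MoE.ofVectors k w r v, hr, fun w' f' => ?_⟩
    have hf' : ∀ x, f'.eval constActivation x = 0 := by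
      intro x
      refine f'.eval_of_notMem _ fun S hS _ => ?_
      have h1 : S ∈ (Finset.univ : Finset (Fin m')).powersetCard k' :=
        Finset.mem_powersetCard_univ.mpr hS
      have h2 := Finset.card_pos.mpr ⟨S, h1⟩
      rw [Finset.card_powersetCard, Finset.card_univ, Fintype.card_fin] at h2
      omega
    simp only [hf', sub_zero]
    have hval : ∫ x, ‖(MoE.ofVectors k w r v).eval constActivation x‖ ^ 2 ∂μ = (k : ℝ) ^ 2 := by
      rw [hnorm, ← one_mul ((k : ℝ) ^ 2), ← hsum, Finset.sum_mul]
      refine Finset.sum_congr rfl fun S hS => ?_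
      rw [Finset.sum_const, Finset.mem_powersetCard_univ.mp hS, ← Nat.cast_smul_eq_nsmul ℝ,
        norm_smul]
      simp
    rw [hval]
    nlinarith
  · obtain ⟨v, hv1, hv2⟩ := exists_signVectors hd0 hk (1 / 10000) (by norm_num)
      (fun S => μ.real (routingRegion r S)) (fun _ => measureReal_nonneg) hsum
      (choose_sq_mul_pow_le hk hkm hd)
    refine ⟨MoE.ofVectors k w r v, hr, fun w' f' => ?_⟩
    obtain ⟨Y, hYc, hY⟩ := f'.exists_finset_eval_mem
    set h : EuclideanSpace ℝ (Fin d) → EuclideanSpace ℝ (Fin d) :=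
      fun x => f'.eval constActivation x with hh
    have hm : Measurable h := f'.measurable_eval_constActivation
    have hbsum : ∀ S, ∑ y ∈ Y, μ.real (routingRegion r S ∩ h ⁻¹' {y}) =
        μ.real (routingRegion r S) := by
      intro S
      rw [← measureReal_biUnion_finset]
      · congr 1
        ext x
        simp only [Set.mem_iUnion, Set.mem_inter_iff, Set.mem_preimage, Set.mem_singleton_iff,
          exists_prop]
        exact ⟨fun ⟨y, _, hx, _⟩ => hx, fun hx => ⟨h x, hY x, hx, rfl⟩⟩
      · intro y _ y' _ hne
        exact Set.disjoint_left.mpr fun x hx hx' => hne (hx.2.symm.trans hx'.2)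
      · exact fun y _ => (measurableSet_routingRegion r S).inter (hm (measurableSet_singleton y))
    have hN0 : (0 : ℝ) < m.choose k := by exact_mod_cast Nat.choose_pos (by omega)
    have hcard : 4 * (Y.card : ℝ) * (m.choose k : ℝ) ^ (-0.99 : ℝ) < 1 := by
      have h1 : (1 : ℝ) ≤ m'.choose k' := by exact_mod_cast hN'
      have h2 : (Y.card : ℝ) ≤ m'.choose k' + 1 := by exact_mod_cast hYc
      have h3 : (0 : ℝ) < (m.choose k : ℝ) ^ (0.99 : ℝ) := Real.rpow_pos_of_pos hN0 _
      rw [Real.rpow_neg hN0.le, ← div_eq_mul_inv, div_lt_one h3]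
      linarith
    have hlow := quantization_lower_bound P Y (fun S => ∑ j ∈ S, v j)
      (fun S y => μ.real (routingRegion r S ∩ h ⁻¹' {y})) (fun _ _ => measureReal_nonneg)
      (by simp only [hbsum, hsum]) (fun S T => ((S \ T).card : ℝ) ≤ 1 / 10000 * k)
      (D := 3 / 5 * (1 / 10000) * k * d) (η := (m.choose k : ℝ) ^ (-0.99 : ℝ))
      (fun S hS T hT hST => hv2 S hS T hT (not_le.mp hST))
      (by
        simp only [hbsum]
        rw [← measureReal_collisionSet]
        exact hcol)
      hcard
    rw [MoE.integral_norm_ofVectors_sub_sq hw r v hae hm hY, hnorm]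
    have : 0 < (k : ℝ) * d := by positivity
    -- The error is at least 7.5 · 10⁻⁶ kd, against 10⁻⁶ times a mean square of at most 2kd.
    refine lt_of_lt_of_le ?_ hlow
    linarith

theorem theorem1 :
    ∃ C > (0 : ℝ), ∃ c > (0 : ℝ),
      ∀ (m k w d m' k' : ℕ) (μ : Measure (EuclideanSpace ℝ (Fin d))),
        IsProbabilityMeasure μ → RotationallyInvariant μ → μ ≠ Measure.dirac 0 →
        1 ≤ k → 1 ≤ w →
        C * (k : ℝ) * Real.log (m : ℝ) ^ 2 ≤ (d : ℝ) →
        2 * k ≤ m →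
        (Nat.choose m' k' : ℝ) < c * (Nat.choose m k : ℝ) ^ (0.99 : ℝ) →
        ∃ f : MoE m k w d, Function.Injective f.routing ∧
          ∀ (w' : ℕ) (f' : MoE m' k' w' d),
            (∫ x, ‖f.eval constActivation x - f'.eval constActivation x‖ ^ 2 ∂μ) >
              c * ∫ x, ‖f.eval constActivation x‖ ^ 2 ∂μ := by
  refine ⟨4 * Real.exp (10 ^ 9), by positivity, 1 / 1000000, by norm_num, ?_⟩
  intro m k w d m' k' μ hprob hμ hne hk hw hd hkm hN
  -- Conditioning on nonzero inputs preserves rotational invariance and removes the atom. Undoing it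
  -- scales the mean square of f exactly by q, as f vanishes at 0, and can only add to the error.
  set q := μ {0}ᶜ with hq
  have hq0 : q ≠ 0 := by
    intro h
    apply hne
    have h1 : ∀ᵐ x ∂μ, x = 0 := ae_iff.mpr h
    have h2 : μ.map id = μ.map fun _ => 0 := Measure.map_congr h1
    simpa [Measure.map_const] using h2
  have hqt : q ≠ ⊤ := measure_ne_top μ _
  have hqr : 0 < q.toReal := ENNReal.toReal_pos hq0 hqt
  set ν := ProbabilityTheory.cond μ {0}ᶜ with hν
  have hνp : IsProbabilityMeasure ν := ProbabilityTheory.cond_isProbabilityMeasure hq0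
  have hmeas : MeasurableSet ({0}ᶜ : Set (EuclideanSpace ℝ (Fin d))) :=
    (measurableSet_singleton 0).compl
  have hνrot : RotationallyInvariant ν := by
    intro R
    ext s hs
    rw [Measure.map_apply R.continuous.measurable hs, hν, ProbabilityTheory.cond_apply hmeas,
      ProbabilityTheory.cond_apply hmeas, ← hμ.measure_preimage R ({0}ᶜ ∩ s)]
    congr 2
    ext x
    simp
  have hν0 : ν {0} = 0 := by
    rw [hν, ProbabilityTheory.cond_apply hmeas]
    simp
  obtain ⟨f, hf, hf'⟩ := hνrot.exists_hard_model (m' := m') (k' := k') hν0 hk hw hd hkm hN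
  refine ⟨f, hf, fun w' f' => ?_⟩
  have hint : ∀ g : EuclideanSpace ℝ (Fin d) → ℝ,
      ∫ x in {0}ᶜ, g x ∂μ = q.toReal * ∫ x, g x ∂ν := by
    intro g
    rw [hν, ProbabilityTheory.cond, integral_smul_measure, ENNReal.toReal_inv, smul_eq_mul,
      mul_inv_cancel_left₀ hqr.ne']
  have h1 : ∫ x, ‖f.eval constActivation x‖ ^ 2 ∂μ =
      q.toReal * ∫ x, ‖f.eval constActivation x‖ ^ 2 ∂ν := by
    rw [← hint]
    refine (setIntegral_eq_integral_of_forall_compl_eq_zero fun x hx => ?_).symm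
    have hx0 : x = 0 := by simpa using hx
    simp [hx0, f.eval_zero constActivation hk (by omega)]
  have h2 : q.toReal * ∫ x, ‖f.eval constActivation x - f'.eval constActivation x‖ ^ 2 ∂ν ≤
      ∫ x, ‖f.eval constActivation x - f'.eval constActivation x‖ ^ 2 ∂μ := by
    rw [← hint]
    exact setIntegral_le_integral (f.integrable_norm_sub_sq f' μ)
      (Filter.Eventually.of_forall fun x => sq_nonneg _)
  have h3 := mul_lt_mul_of_pos_left (hf' w' f') hqr
  rw [h1]
  refine lt_of_lt_of_le ?_ h2
  linarith
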